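/- Let $U$ be a unitary operator on a complex Hilbert space $\mathcal H$ and let $\varphi\in\mathcal H$ be a unit vector that is cyclic for $U$, i.e. the linear span of $\{U^k\varphi : k\in\mathbb Z\}$ is dense in $\mathcal H$. Let $P=\langle\varphi,\cdot\,\rangle\varphi$ (inner products are linear in the second argument) and, for $\lambda\in\partial\mathbb D$, let $U_\lambda=U[(1-P)+\lambda P]$, which is unitary. Let $\mu_\lambda$ be the spectral measure of $U_\lambda$ and $\varphi$, i.e. the positive Borel measure on $\partial\mathbb D$ with $\int f\,d\mu_\lambda=\langle\varphi,f(U_\lambda)\varphi\rangle$ for every continuous $f$ on $\partial\mathbb D$; let $\mu=\mu_1$ be that of $U$, and put $$G(z_0)=\int_{\partial\mathbb D}\frac{d\mu(w)}{|z_0-w|^2}\in[0,\infty],\qquad z_0\in\partial\mathbb D .$$ Suppose that $G(z_0)<\infty$ for Lebesgue-a.e. $z_0\in\partial\mathbb D$. Let $\psi\in\mathcal H$ with $\psi\perp\varphi$ and $\|\psi\|\le 1$. Then for Lebesgue-a.e. $\lambda_0\in\partial\mathbb D$ and every $0<p<1$, the limit $$\lim_{r\uparrow1}\bigl|\langle\varphi,(U+rz)(U-rz)^{-1}\psi\rangle\bigr|^p$$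 exists for $\mu_{\lambda_0}$-a.e. $z$ and is $\mu_{\lambda_0}$-integrable, and $$\sup_{n\in\mathbb Z}\bigl|\langle\varphi,U_{\lambda_0}^n\psi\rangle\bigr|\le\Bigl[\int\lim_{r\uparrow1}\bigl|\langle\varphi,(U+rz)(U-rz)^{-1}\psi\rangle\bigr|^p\,d\mu_{\lambda_0}(z)\Bigr]^{1/(2-p)} .$$ -/

import Mathlib

open MeasureTheory Filter Topology Set
open scoped InnerProductSpace ENNReal CompactlySupported

/-- The Borel `σ`-algebra on the unit circle `∂𝔻`. -/
noncomputable instance Circle.instMeasurableSpaceBorel : MeasurableSpace Circle := borel Circle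

instance Circle.instBorelSpace : BorelSpace Circle := ⟨rfl⟩

namespace RankOneUnitary

noncomputable section

set_option linter.unusedSectionVars false

variable {H : Type*} [NormedAddCommGroup H] [InnerProductSpace ℂ H] [CompleteSpace H]

/-- Normalized Lebesgue measure `dθ/2π` on the unit circle `∂𝔻`. -/
def arcMeasure : Measure Circle :=
  ENNReal.ofReal (1 / (2 * Real.pi)) •
    (volume.restrict (Ioc (0 : ℝ) (2 * Real.pi))).map (fun θ : ℝ => Circle.exp θ)

/-- The operator `P = ⟨φ, ·⟩ φ`, the projection onto the multiples of `φ` if `‖φ‖ = 1`. -/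
def proj (φ : H) : H →L[ℂ] H := InnerProductSpace.rankOne ℂ φ φ

/-- The operator `(1 - P) + λ P`. -/
def phase (φ : H) (l : Circle) : H →L[ℂ] H := (1 - proj φ) + (l : ℂ) • proj φ

theorem proj_mul_proj {φ : H} (hφ : ‖φ‖ = 1) : proj φ * proj φ = proj φ := by
  ext x
  simp [proj, hφ]

theorem star_proj (φ : H) : star (proj φ) = proj φ := by
  simp [proj, ContinuousLinearMap.star_eq_adjoint]

theorem star_phase (φ : H) (l : Circle) : star (phase φ l) = phase φ l⁻¹ := by
  simp [phase, star_proj, ← Circle.coe_inv_eq_conj]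

theorem phase_mul_phase {φ : H} (hφ : ‖φ‖ = 1) (l m : Circle) :
    phase φ l * phase φ m = phase φ (l * m) := by
  have h := proj_mul_proj hφ
  simp only [phase, mul_add, add_mul, mul_sub, sub_mul, mul_one, one_mul, smul_mul_assoc,
    mul_smul_comm, h, Circle.coe_mul, sub_self, zero_add]
  rw [smul_smul, mul_comm (m : ℂ) (l : ℂ)]
  abel

theorem phase_one (φ : H) : phase φ 1 = 1 := by
  simp [phase]

theorem phase_mem_unitary {φ : H} (hφ : ‖φ‖ = 1) (l : Circle) :
    phase φ l ∈ unitary (H →L[ℂ] H) := by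
  rw [Unitary.mem_iff, star_phase, phase_mul_phase hφ, phase_mul_phase hφ]
  simp [phase_one]

/-- The rank one perturbation `U_λ = U ((1 - P) + λ P)` of the unitary `U`, itself a unitary. -/
def perturb (U : unitary (H →L[ℂ] H)) {φ : H} (hφ : ‖φ‖ = 1) (l : Circle) :
    unitary (H →L[ℂ] H) :=
  U * ⟨phase φ l, phase_mem_unitary hφ l⟩

/-- `φ` is cyclic for the unitary `U`: the vectors `U ^ k φ`, `k ∈ ℤ`, span a dense subspace. -/
def IsCyclicVector (U : unitary (H →L[ℂ] H)) (φ : H) : Prop :=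
  (Submodule.span ℂ (range fun k : ℤ => ((U ^ k : unitary (H →L[ℂ] H)) : H →L[ℂ] H) φ)
    ).topologicalClosure = ⊤

theorem mem_circle (U : unitary (H →L[ℂ] H)) (x : spectrum ℂ (U : H →L[ℂ] H)) :
    (x : ℂ) ∈ Submonoid.unitSphere ℂ :=
  spectrum.subset_circle_of_unitary U.2 x.2

/-- The inclusion of the spectrum of a unitary into the unit circle. -/
def specIncl (U : unitary (H →L[ℂ] H)) : C(spectrum ℂ (U : H →L[ℂ] H), Circle) where
  toFun x := ⟨x, mem_circle U x⟩
  continuous_toFun := Continuous.subtype_mk continuous_subtype_val _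

/-- A real continuous function on the circle, as a complex function on the spectrum of `U`. -/
def restrictSpec (U : unitary (H →L[ℂ] H)) (f : C_c(Circle, ℝ)) :
    C(spectrum ℂ (U : H →L[ℂ] H), ℂ) where
  toFun x := ((f (specIncl U x) : ℝ) : ℂ)
  continuous_toFun := by fun_prop

/-- The operator `f(U)` given by the continuous functional calculus. -/
def funcalc (U : unitary (H →L[ℂ] H)) (f : C_c(Circle, ℝ)) : H →L[ℂ] H :=
  cfcHom (R := ℂ) (a := (U : H →L[ℂ] H)) (p := IsStarNormal) inferInstance (restrictSpec U f)

/-- The positive linear functional `f ↦ ⟨φ, f(U) φ⟩` on the real continuous functions on `∂𝔻`. -/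
def spectralFunctional (U : unitary (H →L[ℂ] H)) (φ : H) : C_c(Circle, ℝ) →ₚ[ℝ] ℝ :=
  PositiveLinearMap.mk₀
    { toFun := fun f => (⟪φ, funcalc U f φ⟫_ℂ).re
      map_add' := by
        intro f g
        have : restrictSpec U (f + g) = restrictSpec U f + restrictSpec U g := by
          ext x; simp [restrictSpec]
        simp [funcalc, this]
      map_smul' := by
        intro c f
        have : restrictSpec U (c • f) = (c : ℂ) • restrictSpec U f := by
          ext x; simp [restrictSpec]
        simp [funcalc, this] }
    (by
      intro f hf
      let g : C(spectrum ℂ (U : H →L[ℂ] H), ℂ) :=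
        ⟨fun x => ((Real.sqrt (f (specIncl U x)) : ℝ) : ℂ), by fun_prop⟩
      have hg : restrictSpec U f = star g * g := by
        ext x
        have h0 : 0 ≤ f (specIncl U x) := hf _
        simp [restrictSpec, g, ← Complex.ofReal_mul, Real.mul_self_sqrt h0]
      change 0 ≤ (⟪φ, funcalc U f φ⟫_ℂ).re
      rw [funcalc, hg, map_mul, map_star, ContinuousLinearMap.star_eq_adjoint,
        mul_apply_eq_comp, ContinuousLinearMap.adjoint_inner_right]
      exact inner_self_nonneg (𝕜 := ℂ))

/-- The spectral measure of the unitary `U` and the vector `φ`: the measure `μ` on `∂𝔻` with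
`∫ f dμ = ⟨φ, f(U) φ⟩` for all continuous `f`. -/
def spectralMeasure (U : unitary (H →L[ℂ] H)) (φ : H) : Measure Circle :=
  RealRMK.rieszMeasure (spectralFunctional U φ)

theorem integral_spectralMeasure (U : unitary (H →L[ℂ] H)) (φ : H) (f : C_c(Circle, ℝ)) :
    ∫ z, f z ∂(spectralMeasure U φ) = (⟪φ, funcalc U f φ⟫_ℂ).re :=
  RealRMK.integral_rieszMeasure _ f

/-- `G(z₀) = ∫ |z₀ - w|⁻² dμ(w)` with values in `[0, ∞]`; the integrand is `∞` at `w = z₀`. -/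
def simonWolffG (U : unitary (H →L[ℂ] H)) (φ : H) (z₀ : Circle) : ℝ≥0∞ :=
  ∫⁻ w, (‖(z₀ : ℂ) - (w : ℂ)‖ₑ ^ 2)⁻¹ ∂(spectralMeasure U φ)

/-- The operator `(U + z) (U - z)⁻¹`; used for `|z| < 1`, where `U - z` is invertible. -/
def cayley (U : unitary (H →L[ℂ] H)) (z : ℂ) : H →L[ℂ] H :=
  ((U : H →L[ℂ] H) + z • 1) * Ring.inverse ((U : H →L[ℂ] H) - z • 1)

/-- The function `r ↦ |⟨φ, (U + rz)(U - rz)⁻¹ ψ⟩| ^ p`. -/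
def radial (U : unitary (H →L[ℂ] H)) (φ ψ : H) (p : ℝ) (z : Circle) (r : ℝ) : ℝ :=
  ‖⟪φ, cayley U ((r : ℂ) * (z : ℂ)) ψ⟫_ℂ‖ ^ p

/-- The boundary value `lim_{r ↑ 1} |⟨φ, (U + rz)(U - rz)⁻¹ ψ⟩| ^ p` (arbitrary where the limit
does not exist). -/
def radialLimit (U : unitary (H →L[ℂ] H)) (φ ψ : H) (p : ℝ) (z : Circle) : ℝ :=
  limUnder (𝓝[<] (1 : ℝ)) (radial U φ ψ p z)

end

end RankOneUnitary

open RankOneUnitary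

/-! Write `ν` for the spectral measure of `U_λ` and `φ`. Averaging `ν` over `λ` gives normalized
Lebesgue measure (`bind_spectralMeasure_perturb`), so for a.e. `λ` the hypothesis gives `G < ∞`
`ν`-a.e.

Such a `ν` is pure point. The rank one resolvent identity bounds the energy `∫ |w - rz|⁻² dν` by `4
G(z) (1 + 2 ∫ |w - rz|⁻¹ dν)²`. If `z` is not an atom, the first power is negligible against the
square root of the energy, and the bound closes up to a finite energy at `z`
(`energy_lt_top_of_radial_bound`). But the energy of any measure is infinite almost everywhere for
that measure (`ae_energy_eq_top`), so `ν`-a.e. point is an atom.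

Let `g ∈ L²(ν)` represent `ψ`, so that `⟨φ, h(U_λ) ψ⟩ = ∫ h g dν` and `∫ |g|² dν ≤ ‖ψ‖² ≤ 1`. The
resolvent identity writes `⟨φ, (U + rz)(U - rz)⁻¹ ψ⟩` as a quotient of Cauchy integrals against `ν`;
at an atom the mass of `z` cancels as `r ↑ 1`, leaving `2 g(z) / (λ⁻¹ - 1)`, of modulus at least
`|g(z)|`. Finally `|⟨φ, U_λⁿ ψ⟩| = |∫ wⁿ g dν| ≤ ∫ |g| dν`, and Hölder interpolates this first
moment between the moments of order `p` and `2`. -/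

namespace RankOneUnitary

/-! ### Functional calculus on the circle and the spectral representation. -/

section FunctionalCalculus

variable {H : Type*} [NormedAddCommGroup H] [InnerProductSpace ℂ H] [CompleteSpace H]

/-- The inclusion of the unit circle into `ℂ`, as a continuous function. -/
def circleId : C(Circle, ℂ) := ⟨fun w => (w : ℂ), continuous_subtype_val⟩

@[simp]
theorem circleId_apply (w : Circle) : circleId w = w := rfl

/-- The Cauchy kernel `w ↦ (w - ζ)⁻¹` on the unit circle, for `|ζ| < 1`. -/
noncomputable def cauchyKernel (ζ : ℂ) (hζ : ‖ζ‖ < 1) : C(Circle, ℂ) where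
  toFun w := ((w : ℂ) - ζ)⁻¹
  continuous_toFun := by
    refine Continuous.inv₀ (by fun_prop) fun w hw => ?_
    rw [← sub_eq_zero.1 hw, Circle.norm_coe] at hζ
    exact lt_irrefl _ hζ

@[simp]
theorem cauchyKernel_apply (ζ : ℂ) (hζ : ‖ζ‖ < 1) (w : Circle) :
    cauchyKernel ζ hζ w = ((w : ℂ) - ζ)⁻¹ := rfl

theorem circle_coe_sub_ne_zero {ζ : ℂ} (hζ : ‖ζ‖ < 1) (w : Circle) : (w : ℂ) - ζ ≠ 0 := by
  intro hw
  rw [← sub_eq_zero.1 hw, Circle.norm_coe] at hζ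
  exact lt_irrefl _ hζ

theorem circleId_sub_mul_cauchyKernel (ζ : ℂ) (hζ : ‖ζ‖ < 1) :
    (circleId - ζ • 1) * cauchyKernel ζ hζ = 1 := by
  ext w
  simp [mul_inv_cancel₀ (circle_coe_sub_ne_zero hζ w)]

/-- The continuous functional calculus of a unitary, on continuous functions on the circle. -/
noncomputable def circleCalc (V : unitary (H →L[ℂ] H)) : C(Circle, ℂ) →⋆ₐ[ℂ] (H →L[ℂ] H) :=
  (cfcHom (R := ℂ) (a := (V : H →L[ℂ] H)) (p := IsStarNormal) inferInstance).comp
    (ContinuousMap.compStarAlgHom' ℂ ℂ (specIncl V))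

theorem circleCalc_circleId (V : unitary (H →L[ℂ] H)) : circleCalc V circleId = V :=
  cfcHom_id (R := ℂ) (a := (V : H →L[ℂ] H)) (p := IsStarNormal) inferInstance

theorem circleCalc_sub_mul_cauchyKernel (V : unitary (H →L[ℂ] H)) (ζ : ℂ) (hζ : ‖ζ‖ < 1) :
    ((V : H →L[ℂ] H) - ζ • 1) * circleCalc V (cauchyKernel ζ hζ) = 1 := by
  have h := congrArg (circleCalc V) (circleId_sub_mul_cauchyKernel ζ hζ)
  simpa [circleCalc_circleId] using h

theorem circleCalc_cauchyKernel_mul_sub (V : unitary (H →L[ℂ] H)) (ζ : ℂ) (hζ : ‖ζ‖ < 1) :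
    circleCalc V (cauchyKernel ζ hζ) * ((V : H →L[ℂ] H) - ζ • 1) = 1 := by
  have h := congrArg (circleCalc V)
    ((mul_comm _ _).trans (circleId_sub_mul_cauchyKernel ζ hζ))
  simpa [circleCalc_circleId] using h

theorem inverse_sub_eq (V : unitary (H →L[ℂ] H)) (ζ : ℂ) (hζ : ‖ζ‖ < 1) :
    Ring.inverse ((V : H →L[ℂ] H) - ζ • 1) = circleCalc V (cauchyKernel ζ hζ) :=
  Ring.inverse_unit (⟨_, _, circleCalc_sub_mul_cauchyKernel V ζ hζ,
    circleCalc_cauchyKernel_mul_sub V ζ hζ⟩ : (H →L[ℂ] H)ˣ)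

/-- The function `w ↦ w ^ n` on the circle. -/
noncomputable def circlePow (n : ℤ) : C(Circle, ℂ) :=
  ⟨fun w => ((w ^ n : Circle) : ℂ), continuous_subtype_val.comp (continuous_zpow n)⟩

@[simp]
theorem circlePow_apply (n : ℤ) (w : Circle) : circlePow n w = ((w ^ n : Circle) : ℂ) := rfl

theorem circlePow_natCast (n : ℕ) : circlePow n = circleId ^ n := by
  ext w; simp

theorem circlePow_neg (n : ℤ) : circlePow (-n) = star (circlePow n) := by
  ext w
  simp only [circlePow_apply, zpow_neg, Circle.coe_inv_eq_conj, ContinuousMap.star_apply]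
  rfl

theorem circleCalc_circlePow (V : unitary (H →L[ℂ] H)) (n : ℤ) :
    circleCalc V (circlePow n) = ((V ^ n : unitary (H →L[ℂ] H)) : H →L[ℂ] H) := by
  have hnat (n : ℕ) : circleCalc V (circlePow n) =
      ((V ^ n : unitary (H →L[ℂ] H)) : H →L[ℂ] H) := by
    rw [circlePow_natCast, map_pow, circleCalc_circleId]; rfl
  obtain ⟨n, rfl | rfl⟩ := n.eq_nat_or_neg
  · rw [hnat, zpow_natCast]
  · rw [circlePow_neg, map_star, hnat, zpow_neg, zpow_natCast, ← Unitary.star_eq_inv]; rfl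

instance (V : unitary (H →L[ℂ] H)) (φ : H) : IsFiniteMeasure (spectralMeasure V φ) :=
  inferInstanceAs (IsFiniteMeasure (RealRMK.rieszMeasure _))

instance (V : unitary (H →L[ℂ] H)) (φ : H) : (spectralMeasure V φ).Regular :=
  inferInstanceAs (RealRMK.rieszMeasure _).Regular

theorem _root_.ContinuousMap.integrable_of_isFiniteMeasure {X E : Type*} [TopologicalSpace X]
    [CompactSpace X] [MeasurableSpace X] [BorelSpace X] [NormedAddCommGroup E]
    [SecondCountableTopologyEither X E] (μ : Measure X) [IsFiniteMeasure μ] (f : C(X, E)) :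
    Integrable f μ :=
  Integrable.of_bound f.continuous.aestronglyMeasurable ‖f‖ (ae_of_all _ f.norm_coe_le_norm)

/-- The spectral measure is built from real parts only; the imaginary part vanishes because a real
function of `V` is self-adjoint. -/
theorem inner_circleCalc_ofReal (V : unitary (H →L[ℂ] H)) (φ : H) (f : C(Circle, ℝ)) :
    ⟪φ, circleCalc V ((ContinuousMap.mk _ Complex.continuous_ofReal).comp f) φ⟫_ℂ =
      ((∫ w, f w ∂(spectralMeasure V φ) : ℝ) : ℂ) := by
  set F : C(Circle, ℂ) := (ContinuousMap.mk _ Complex.continuous_ofReal).comp f with hF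
  have hsa : star F = F := by
    ext w; simp [F]
  have hadj : ContinuousLinearMap.adjoint (circleCalc V F) = circleCalc V F := by
    rw [← ContinuousLinearMap.star_eq_adjoint, ← map_star, hsa]
  have him : (⟪φ, circleCalc V F φ⟫_ℂ).im = 0 := by
    rw [← Complex.conj_eq_iff_im, inner_conj_symm]
    conv_rhs => rw [← hadj, ContinuousLinearMap.adjoint_inner_right]
  have hre := integral_spectralMeasure V φ (CompactlySupportedContinuousMap.continuousMapEquiv f)
  have : funcalc V (CompactlySupportedContinuousMap.continuousMapEquiv f) = circleCalc V F := rfl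
  rw [this] at hre
  refine Complex.ext ?_ ?_
  · rw [← hre]; rfl
  · rw [him, Complex.ofReal_im]

theorem inner_circleCalc_self (V : unitary (H →L[ℂ] H)) (φ : H) (h : C(Circle, ℂ)) :
    ⟪φ, circleCalc V h φ⟫_ℂ = ∫ w, h w ∂(spectralMeasure V φ) := by
  let a : C(Circle, ℝ) := ⟨fun w => (h w).re, by fun_prop⟩
  let b : C(Circle, ℝ) := ⟨fun w => (h w).im, by fun_prop⟩
  have hab : h = (ContinuousMap.mk _ Complex.continuous_ofReal).comp a +
      Complex.I • (ContinuousMap.mk _ Complex.continuous_ofReal).comp b := by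
    ext w
    simp [a, b, mul_comm Complex.I, Complex.re_add_im]
  conv_lhs => rw [hab]
  rw [map_add, map_smul, add_apply, smul_apply,
    inner_add_right, inner_smul_right, inner_circleCalc_ofReal, inner_circleCalc_ofReal, mul_comm]
  exact integral_re_add_im (h.integrable_of_isFiniteMeasure _)

theorem inner_circleCalc_circleCalc (V : unitary (H →L[ℂ] H)) (φ : H) (h k : C(Circle, ℂ)) :
    ⟪circleCalc V h φ, circleCalc V k φ⟫_ℂ = ∫ w, star (h w) * k w ∂(spectralMeasure V φ) := by
  have := inner_circleCalc_self V φ (star h * k)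
  rw [map_mul, map_star, ContinuousLinearMap.star_eq_adjoint, mul_apply_eq_comp,
    ContinuousLinearMap.adjoint_inner_right] at this
  exact this

theorem norm_circleCalc_sq (V : unitary (H →L[ℂ] H)) (φ : H) (h : C(Circle, ℂ)) :
    ‖circleCalc V h φ‖ ^ 2 = ∫ w, ‖h w‖ ^ 2 ∂(spectralMeasure V φ) := by
  have h1 := inner_circleCalc_circleCalc V φ h h
  rw [inner_self_eq_norm_sq_to_K] at h1
  have h2 : ∀ w, star (h w) * h w = ((‖h w‖ ^ 2 : ℝ) : ℂ) := fun w => by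
    rw [← starRingEnd_apply, Complex.conj_mul']; push_cast; rfl
  simp_rw [h2] at h1
  rw [integral_complex_ofReal] at h1
  exact Complex.ofReal_injective (by rw [← h1]; push_cast; rfl)

theorem norm_circleCalc_eq_norm_toLp (V : unitary (H →L[ℂ] H)) (φ : H) (h : C(Circle, ℂ)) :
    ‖circleCalc V h φ‖ = ‖ContinuousMap.toLp 2 (spectralMeasure V φ) ℂ h‖ := by
  have h1 := ContinuousMap.inner_toLp (𝕜 := ℂ) (spectralMeasure V φ) h h
  have h2 := inner_circleCalc_circleCalc V φ h h
  rw [inner_self_eq_norm_sq_to_K] at h1 h2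
  have h3 : ((‖circleCalc V h φ‖ : ℂ)) ^ 2 =
      (‖ContinuousMap.toLp 2 (spectralMeasure V φ) ℂ h‖ : ℂ) ^ 2 := by
    refine h2.trans (Eq.trans ?_ h1.symm)
    simp [mul_comm]
  have h4 : ‖circleCalc V h φ‖ ^ 2 =
      ‖ContinuousMap.toLp 2 (spectralMeasure V φ) ℂ h‖ ^ 2 := by exact_mod_cast h3
  exact (sq_eq_sq₀ (norm_nonneg _) (norm_nonneg _)).1 h4

/-- Since `‖h(V) φ‖` is the `L²` norm of `h`, the functional `h ↦ ⟨ψ, h(V) φ⟩` is bounded by `‖ψ‖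
‖h‖₂` on a dense subspace of `L²`. It extends, and the Riesz theorem supplies `g` with `‖g‖₂ ≤ ‖ψ‖`.
-/
theorem exists_spectral_representative (V : unitary (H →L[ℂ] H)) (φ ψ : H) :
    ∃ g : Circle → ℂ, MemLp g 2 (spectralMeasure V φ) ∧
      ∫ w, ‖g w‖ ^ 2 ∂(spectralMeasure V φ) ≤ ‖ψ‖ ^ 2 ∧
      ∀ h : C(Circle, ℂ), ⟪φ, circleCalc V h ψ⟫_ℂ = ∫ w, h w * g w ∂(spectralMeasure V φ) := by
  set ν := spectralMeasure V φ
  let e : C(Circle, ℂ) →ₗ[ℂ] Lp ℂ 2 ν := (ContinuousMap.toLp 2 ν ℂ).toLinearMap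
  let f : C(Circle, ℂ) →ₗ[ℂ] ℂ :=
    { toFun := fun h => ⟪ψ, circleCalc V h φ⟫_ℂ
      map_add' := fun h k => by simp
      map_smul' := fun c h => by simp }
  have hdense : DenseRange e := ContinuousMap.toLp_denseRange ℂ ν ℂ (by simp)
  have hbound (h : C(Circle, ℂ)) : ‖f h‖ ≤ ‖ψ‖ * ‖e h‖ :=
    (norm_inner_le_norm _ _).trans_eq (by rw [norm_circleCalc_eq_norm_toLp]; rfl)
  let G : Lp ℂ 2 ν := (InnerProductSpace.toDual ℂ _).symm (f.extendOfNorm e)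
  have hG (h : C(Circle, ℂ)) : ⟪G, e h⟫_ℂ = f h := by
    rw [InnerProductSpace.toDual_symm_apply]
    exact LinearMap.extendOfNorm_eq hdense ⟨_, hbound⟩ h
  have hGn : ‖G‖ ≤ ‖ψ‖ := by
    rw [LinearIsometryEquiv.norm_map]
    exact LinearMap.opNorm_extendOfNorm_le hdense (norm_nonneg _) hbound
  refine ⟨fun w => G w, Lp.memLp G, ?_, fun h => ?_⟩
  · have h1 : ∫ w, ‖G w‖ ^ 2 ∂ν = ‖G‖ ^ 2 := by
      have := L2.inner_def (𝕜 := ℂ) G G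
      rw [inner_self_eq_norm_sq_to_K] at this
      simp_rw [inner_self_eq_norm_sq_to_K, RCLike.ofReal_eq_complex_ofReal, ← Complex.ofReal_pow]
        at this
      rw [integral_complex_ofReal] at this
      exact (Complex.ofReal_injective this).symm
    rw [h1]
    gcongr
  · have h1 : ⟪φ, circleCalc V h ψ⟫_ℂ = star (f (star h)) := by
      change _ = star ⟪ψ, circleCalc V (star h) φ⟫_ℂ
      rw [map_star, ContinuousLinearMap.star_eq_adjoint, ContinuousLinearMap.adjoint_inner_right,
        ← starRingEnd_apply, inner_conj_symm]
    rw [h1, ← hG, ← starRingEnd_apply, inner_conj_symm, L2.inner_def]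
    refine integral_congr_ae ?_
    filter_upwards [ContinuousMap.coeFn_toLp (p := 2) (𝕜 := ℂ) ν (star h)] with w hw
    change ⟪(ContinuousMap.toLp 2 ν ℂ (star h)) w, G w⟫_ℂ = _
    rw [hw]
    simp [mul_comm]

end FunctionalCalculus

/-! ### Pointwise energies of measures on the circle. -/

section Energy

theorem circle_dist_eq_norm (z w : Circle) : dist z w = ‖(z : ℂ) - w‖ :=
  dist_eq_norm (z : ℂ) w

theorem dist_circleExp_le (a b : ℝ) : dist (Circle.exp a) (Circle.exp b) ≤ |a - b| := by
  rw [circle_dist_eq_norm, Circle.coe_exp, Circle.coe_exp]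
  have h : Complex.exp (a * Complex.I) - Complex.exp (b * Complex.I) =
      Complex.exp (b * Complex.I) * (Complex.exp (Complex.I * ((a - b : ℝ) : ℂ)) - 1) := by
    rw [mul_sub, ← Complex.exp_add, mul_one]
    congr 2
    push_cast
    ring
  rw [h, norm_mul, Complex.norm_exp_ofReal_mul_I, one_mul]
  exact Real.norm_exp_I_mul_ofReal_sub_one_le

/-- Chebyshev's inequality: the integrand is at least `d⁻²` on the ball. -/
theorem measure_closedBall_le_of_energy_le {ν : Measure Circle} {z : Circle} {K : ℝ≥0∞}
    (hK : ∫⁻ w, (‖(z : ℂ) - (w : ℂ)‖ₑ ^ 2)⁻¹ ∂ν ≤ K) {d : ℝ} (hd : 0 < d) :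
    ν (Metric.closedBall z d) ≤ K * ENNReal.ofReal d ^ 2 := by
  have hsub : Metric.closedBall z d ⊆
      {w | (ENNReal.ofReal d ^ 2)⁻¹ ≤ (‖(z : ℂ) - (w : ℂ)‖ₑ ^ 2)⁻¹} := by
    intro w hw
    rw [Metric.mem_closedBall, dist_comm, circle_dist_eq_norm] at hw
    rw [mem_ofPred_eq, ENNReal.inv_le_inv, ← ofReal_norm]
    gcongr
  have hd0 : ENNReal.ofReal d ^ 2 ≠ 0 := by simpa using hd
  have hdt : ENNReal.ofReal d ^ 2 ≠ ∞ := by simp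
  have h := mul_meas_ge_le_lintegral (μ := ν)
    (f := fun w : Circle => (‖(z : ℂ) - (w : ℂ)‖ₑ ^ 2)⁻¹)
    (by fun_prop) (ENNReal.ofReal d ^ 2)⁻¹
  have h2 : (ENNReal.ofReal d ^ 2)⁻¹ * ν (Metric.closedBall z d) ≤ K :=
    (mul_le_mul_right (measure_mono hsub) _).trans (h.trans hK)
  rw [mul_comm] at h2
  rwa [← ENNReal.div_le_iff hd0 hdt, div_eq_mul_inv]

theorem exists_arc_cover (N : ℕ) (hN : 0 < N) (z : Circle) :
    ∃ i ∈ Finset.range N, z ∈ Circle.exp '' Icc (2 * Real.pi * i / N)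
      (2 * Real.pi * (i + 1) / N) := by
  have hN' : (0 : ℝ) < N := by exact_mod_cast hN
  have hpi := Real.two_pi_pos
  obtain ⟨t, ⟨ht0, ht1⟩, rfl⟩ : ∃ t ∈ Ico 0 (2 * Real.pi), Circle.exp t = z := by
    obtain ⟨t, ht, h⟩ := Circle.periodic_exp.exists_mem_Ico₀ Real.two_pi_pos (Complex.arg z)
    exact ⟨t, ht, by rw [← h, Circle.exp_arg]⟩
  have hs0 : 0 ≤ t * N / (2 * Real.pi) := by positivity
  refine ⟨⌊t * N / (2 * Real.pi)⌋₊, ?_, t, ⟨?_, ?_⟩, rfl⟩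
  · rw [Finset.mem_range, Nat.floor_lt hs0, div_lt_iff₀ hpi, mul_comm]
    gcongr
  · have := Nat.floor_le hs0
    rw [le_div_iff₀ hpi] at this
    rw [div_le_iff₀ hN']
    linarith
  · have := (Nat.lt_floor_add_one (t * N / (2 * Real.pi))).le
    rw [div_le_iff₀ hpi] at this
    rw [le_div_iff₀ hN']
    linarith

/-- Cut the circle into `N` arcs of length `2π/N`. An arc meeting the set lies in a ball centred at
a point of energy at most `K`, so it carries mass at most `K (2π/N)²`; the total `K (2π)²/N` tends
to `0`. -/
theorem measure_energy_le_eq_zero (ν : Measure Circle) (K : ℕ) :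
    ν {z | ∫⁻ w, (‖(z : ℂ) - (w : ℂ)‖ₑ ^ 2)⁻¹ ∂ν ≤ K} = 0 := by
  set A : Set Circle := {z : Circle | ∫⁻ w, (‖(z : ℂ) - (w : ℂ)‖ₑ ^ 2)⁻¹ ∂ν ≤ K}
  have hpi := Real.two_pi_pos
  have hbound (N : ℕ) (hN : 0 < N) :
      ν A ≤ ENNReal.ofReal (K * (2 * Real.pi) ^ 2 / N) := by
    have hN' : (0 : ℝ) < N := by exact_mod_cast hN
    have hcov : A ⊆ ⋃ i ∈ Finset.range N, A ∩ Circle.exp '' Icc (2 * Real.pi * i / N)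
        (2 * Real.pi * (i + 1) / N) := by
      intro z hz
      obtain ⟨i, hi, hzi⟩ := exists_arc_cover N hN z
      exact mem_biUnion hi ⟨hz, hzi⟩
    have harc (i : ℕ) : ν (A ∩ Circle.exp '' Icc (2 * Real.pi * i / N)
        (2 * Real.pi * (i + 1) / N)) ≤ K * ENNReal.ofReal (2 * Real.pi / N) ^ 2 := by
      rcases (A ∩ Circle.exp '' Icc (2 * Real.pi * i / N)
        (2 * Real.pi * (i + 1) / N)).eq_empty_or_nonempty with h | ⟨z, hzA, s, hs, rfl⟩
      · simp [h]
      · refine (measure_mono ?_).trans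
          (measure_closedBall_le_of_energy_le hzA (d := 2 * Real.pi / N) (by positivity))
        rintro _ ⟨-, t, ht, rfl⟩
        refine (dist_circleExp_le t s).trans ?_
        have h1 : 2 * Real.pi * (i + 1) / N = 2 * Real.pi * i / N + 2 * Real.pi / N := by ring
        rw [h1] at hs ht
        rw [abs_le]
        constructor <;> linarith [hs.1, hs.2, ht.1, ht.2]
    calc ν A ≤ ∑ i ∈ Finset.range N, ν (A ∩ Circle.exp '' Icc (2 * Real.pi * i / N)
        (2 * Real.pi * (i + 1) / N)) := (measure_mono hcov).trans (measure_biUnion_finset_le _ _)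
      _ ≤ ∑ i ∈ Finset.range N, K * ENNReal.ofReal (2 * Real.pi / N) ^ 2 :=
        Finset.sum_le_sum fun i _ => harc i
      _ = ENNReal.ofReal (K * (2 * Real.pi) ^ 2 / N) := by
        rw [Finset.sum_const, Finset.card_range, nsmul_eq_mul, ← ENNReal.ofReal_natCast,
          ← ENNReal.ofReal_natCast, ← ENNReal.ofReal_pow (by positivity),
          ← ENNReal.ofReal_mul (by positivity), ← ENNReal.ofReal_mul (by positivity)]
        congr 1
        field_simp
  have hlim : Tendsto (fun N : ℕ => ENNReal.ofReal (K * (2 * Real.pi) ^ 2 / N)) atTop (𝓝 0) := by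
    rw [← ENNReal.ofReal_zero]
    exact ENNReal.tendsto_ofReal (tendsto_const_div_atTop_nhds_zero_nat _)
  exact le_antisymm (ge_of_tendsto hlim (eventually_atTop.2 ⟨1, fun N hN => hbound N hN⟩)) bot_le

theorem ae_energy_eq_top (ν : Measure Circle) :
    ∀ᵐ z : Circle ∂ν, ∫⁻ w, (‖(z : ℂ) - (w : ℂ)‖ₑ ^ 2)⁻¹ ∂ν = ∞ := by
  have h : ∀ᵐ z : Circle ∂ν, ∀ K : ℕ, ¬ ∫⁻ w, (‖(z : ℂ) - (w : ℂ)‖ₑ ^ 2)⁻¹ ∂ν ≤ K := by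
    rw [ae_all_iff]
    intro K
    rw [ae_iff]
    simpa using measure_energy_le_eq_zero ν K
  filter_upwards [h] with z hz
  by_contra hne
  obtain ⟨K, hK⟩ := ENNReal.exists_nat_gt hne
  exact hz K hK.le

theorem norm_sub_le_two_mul_norm_sub_radial (z w : Circle) {r : ℝ} (h0 : 0 ≤ r) (h1 : r < 1) :
    ‖(w : ℂ) - z‖ ≤ 2 * ‖(w : ℂ) - r * z‖ := by
  have hr : ‖(r : ℂ) * z‖ = r := by
    rw [norm_mul, Circle.norm_coe, mul_one, Complex.norm_real, Real.norm_eq_abs, abs_of_nonneg h0]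
  have ha : ‖(r : ℂ) * z - z‖ = 1 - r := by
    have : (r : ℂ) * z - z = ((r - 1 : ℝ) : ℂ) * z := by push_cast; ring
    rw [this, norm_mul, Circle.norm_coe, Complex.norm_real, mul_one, Real.norm_eq_abs,
      abs_of_neg (by linarith)]
    ring
  have hb : 1 - r ≤ ‖(w : ℂ) - r * z‖ := by
    have := norm_sub_norm_le (w : ℂ) (r * z)
    rwa [hr, Circle.norm_coe] at this
  have hc : ‖(w : ℂ) - z‖ ≤ ‖(w : ℂ) - r * z‖ + ‖(r : ℂ) * z - z‖ :=
    norm_sub_le_norm_sub_add_norm_sub _ _ _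
  linarith

theorem norm_radial_lt_one (z : Circle) {r : ℝ} (h0 : 0 ≤ r) (h1 : r < 1) :
    ‖(r : ℂ) * z‖ < 1 := by
  rwa [norm_mul, Circle.norm_coe, mul_one, Complex.norm_real, Real.norm_eq_abs, abs_of_nonneg h0]

theorem enorm_inv_sq_eq {a : ℂ} (ha : a ≠ 0) :
    (‖a‖ₑ ^ 2)⁻¹ = ENNReal.ofReal (‖a⁻¹‖ ^ 2) := by
  have h : 0 < ‖a‖ := norm_pos_iff.2 ha
  rw [norm_inv, inv_pow, ENNReal.ofReal_inv_of_pos (by positivity),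
    ENNReal.ofReal_pow (by positivity), ofReal_norm]

/-- Fatou's lemma along `r = 1 - 1/(n+1)`. -/
theorem energy_le_of_radial_le {ν : Measure Circle} [IsFiniteMeasure ν] {z : Circle} {C : ℝ}
    (hC : ∀ (r : ℝ) (h0 : 0 ≤ r) (h1 : r < 1),
      ∫ w, ‖cauchyKernel (r * z) (norm_radial_lt_one z h0 h1) w‖ ^ 2 ∂ν ≤ C) :
    ∫⁻ w, (‖(z : ℂ) - (w : ℂ)‖ₑ ^ 2)⁻¹ ∂ν ≤ ENNReal.ofReal C := by
  let r : ℕ → ℝ := fun n => 1 - 1 / ((n : ℝ) + 1)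
  have h1 (n : ℕ) : r n < 1 := by
    have : 0 < 1 / ((n : ℝ) + 1) := Nat.one_div_pos_of_nat
    simp only [r]; linarith
  have h0 (n : ℕ) : 0 ≤ r n := by
    have : 1 / ((n : ℝ) + 1) ≤ 1 := by
      rw [div_le_one (by positivity)]; linarith [n.cast_nonneg (α := ℝ)]
    simp only [r]; linarith
  have hr : Tendsto r atTop (𝓝 1) := by
    simpa [r] using tendsto_one_div_add_atTop_nhds_zero_nat (𝕜 := ℝ) |>.const_sub 1
  let F : ℕ → Circle → ℝ≥0∞ := fun n w => (‖(r n : ℂ) * z - (w : ℂ)‖ₑ ^ 2)⁻¹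
  have hlim (w : Circle) : Tendsto (fun n => F n w) atTop (𝓝 (‖(z : ℂ) - (w : ℂ)‖ₑ ^ 2)⁻¹) := by
    have hc : Tendsto (fun n => (r n : ℂ) * z - w) atTop (𝓝 (((1 : ℝ) : ℂ) * z - w)) :=
      (((Complex.continuous_ofReal.tendsto 1).comp hr).mul_const _).sub_const _
    rw [Complex.ofReal_one, one_mul] at hc
    exact (continuous_inv.tendsto _).comp
      (((ENNReal.continuous_pow 2).tendsto _).comp hc.enorm)
  have hF (n : ℕ) : ∫⁻ w, F n w ∂ν ≤ ENNReal.ofReal C := by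
    have hk (w : Circle) : F n w = ENNReal.ofReal
        (‖cauchyKernel (r n * z) (norm_radial_lt_one z (h0 n) (h1 n)) w‖ ^ 2) := by
      simp only [F]
      rw [← enorm_neg, neg_sub, enorm_inv_sq_eq
        (circle_coe_sub_ne_zero (norm_radial_lt_one z (h0 n) (h1 n)) w)]
      rfl
    simp_rw [hk]
    rw [← ofReal_integral_eq_lintegral_ofReal]
    · exact ENNReal.ofReal_le_ofReal (hC _ (h0 n) (h1 n))
    · exact ContinuousMap.integrable_of_isFiniteMeasure ν (⟨fun w => ‖cauchyKernel (r n * z)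
        (norm_radial_lt_one z (h0 n) (h1 n)) w‖ ^ 2, by fun_prop⟩ : C(Circle, ℝ))
    · exact ae_of_all _ fun w => by positivity
  calc ∫⁻ w, (‖(z : ℂ) - (w : ℂ)‖ₑ ^ 2)⁻¹ ∂ν = ∫⁻ w, liminf (fun n => F n w) atTop ∂ν :=
        lintegral_congr fun w => ((hlim w).liminf_eq).symm
    _ ≤ liminf (fun n => ∫⁻ w, F n w ∂ν) atTop := lintegral_liminf_le fun n => by
        simp only [F]; fun_prop
    _ ≤ ENNReal.ofReal C := by
        refine (liminf_le_liminf (v := fun _ => ENNReal.ofReal C)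
          (Eventually.of_forall hF)).trans_eq ?_
        simp

/-- A bootstrap. Away from `z` the kernel is bounded uniformly in `r`; near `z` the mass is small
because `z` is not an atom, so there the first moment costs only a small multiple of the square root
of the second, which the left side absorbs. -/
theorem energy_lt_top_of_radial_bound {ν : Measure Circle} [IsFiniteMeasure ν] {z : Circle}
    (hz : ν {z} = 0) {K : ℝ}
    (hK : ∀ (r : ℝ) (h0 : 0 ≤ r) (h1 : r < 1),
      ∫ w, ‖cauchyKernel (r * z) (norm_radial_lt_one z h0 h1) w‖ ^ 2 ∂ν ≤
        K * (1 + 2 * ∫ w, ‖cauchyKernel (r * z) (norm_radial_lt_one z h0 h1) w‖ ∂ν) ^ 2) :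
    ∫⁻ w, (‖(z : ℂ) - (w : ℂ)‖ₑ ^ 2)⁻¹ ∂ν < ∞ := by
  obtain ⟨L, hL1, hLK⟩ : ∃ L : ℝ, 1 ≤ L ∧ K ≤ L ^ 2 :=
    ⟨max 1 K, le_max_left _ _, by nlinarith [le_max_left 1 K, le_max_right 1 K]⟩
  -- With this value `J ≤ L (1 + 2 (ε J + D))` has `J / 2` as its `J`-term on the right, which can
  -- be absorbed.
  set ε : ℝ := 1 / (4 * L) with hε
  have hε0 : 0 < ε := by positivity
  obtain ⟨O, hzO, hO, hνO⟩ := exists_isOpen_lt_of_lt (μ := ν) {z} (ENNReal.ofReal (ε ^ 2))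
    (by rw [hz]; exact ENNReal.ofReal_pos.2 (by positivity))
  obtain ⟨δ, hδ, hball⟩ := Metric.isOpen_iff.1 hO z (hzO rfl)
  have hνB : ν.real (Metric.ball z δ) ≤ ε ^ 2 :=
    ENNReal.toReal_le_of_le_ofReal (by positivity) ((measure_mono hball).trans hνO.le)
  set D : ℝ := 2 / δ * ν.real univ
  have hD : 0 ≤ D := by positivity
  refine (energy_le_of_radial_le (C := (2 * L * (1 + 2 * D)) ^ 2) fun r h0 h1 => ?_).trans_lt
    ENNReal.ofReal_lt_top
  set k := cauchyKernel (r * z) (norm_radial_lt_one z h0 h1)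
  have hint1 : Integrable (fun w => ‖k w‖) ν := (k.integrable_of_isFiniteMeasure ν).norm
  have hint2 : Integrable (fun w => ‖k w‖ ^ 2) ν := ContinuousMap.integrable_of_isFiniteMeasure ν
    (⟨fun w => ‖k w‖ ^ 2, by fun_prop⟩ : C(Circle, ℝ))
  have hmain := hK r h0 h1
  change ∫ w, ‖k w‖ ^ 2 ∂ν ≤ K * (1 + 2 * ∫ w, ‖k w‖ ∂ν) ^ 2 at hmain
  set I1 := ∫ w, ‖k w‖ ∂ν
  set I2 := ∫ w, ‖k w‖ ^ 2 ∂ν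
  have hI1 : 0 ≤ I1 := integral_nonneg fun w => norm_nonneg _
  have hI2 : 0 ≤ I2 := integral_nonneg fun w => by positivity
  -- The maximum with `1` keeps `J` positive, so that it can be divided by.
  set J := max 1 (√I2)
  have hJ1 : 1 ≤ J := le_max_left _ _
  have hJ2 : I2 ≤ J ^ 2 := by
    rw [← Real.sq_sqrt hI2]
    exact pow_le_pow_left₀ (Real.sqrt_nonneg _) (le_max_right _ _) 2
  have hfar : ∫ w in (Metric.ball z δ)ᶜ, ‖k w‖ ∂ν ≤ D := by
    calc ∫ w in (Metric.ball z δ)ᶜ, ‖k w‖ ∂ν ≤ ∫ w in (Metric.ball z δ)ᶜ, 2 / δ ∂ν := by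
          refine setIntegral_mono_on hint1.integrableOn (by simp)
            Metric.isOpen_ball.measurableSet.compl fun w hw => ?_
          rw [mem_compl_iff, Metric.mem_ball, not_lt, circle_dist_eq_norm] at hw
          have := norm_sub_le_two_mul_norm_sub_radial z w h0 h1
          change ‖((w : ℂ) - r * z)⁻¹‖ ≤ _
          rw [norm_inv, inv_le_comm₀ (by linarith) (by positivity), inv_div]
          linarith
      _ ≤ D := by
          rw [setIntegral_const, smul_eq_mul, mul_comm]
          exact mul_le_mul_of_nonneg_left (measureReal_mono (subset_univ _)) (by positivity)
  have hnear : ∫ w in Metric.ball z δ, ‖k w‖ ∂ν ≤ ε * J := by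
    -- Weighted AM-GM; after integration over a ball of mass at most `ε²` each term contributes at
    -- most `ε J / 2`.
    have hpt (x : ℝ) : x ≤ ε / (2 * J) * x ^ 2 + J / (2 * ε) := by
      have h : 0 ≤ (ε * x - J) ^ 2 / (2 * J * ε) := by positivity
      have h' : (ε * x - J) ^ 2 / (2 * J * ε) = ε / (2 * J) * x ^ 2 + J / (2 * ε) - x := by
        field_simp; ring
      linarith
    calc ∫ w in Metric.ball z δ, ‖k w‖ ∂ν
        ≤ ∫ w in Metric.ball z δ, (ε / (2 * J) * ‖k w‖ ^ 2 + J / (2 * ε)) ∂ν :=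
          integral_mono hint1.integrableOn
            (Integrable.add (hint2.const_mul _).integrableOn (integrable_const _))
            fun w => hpt _
      _ = ε / (2 * J) * (∫ w in Metric.ball z δ, ‖k w‖ ^ 2 ∂ν) +
            ν.real (Metric.ball z δ) * (J / (2 * ε)) := by
          rw [integral_add (hint2.const_mul _).integrableOn (integrable_const _), integral_const_mul,
            setIntegral_const, smul_eq_mul]
      _ ≤ ε / (2 * J) * J ^ 2 + ε ^ 2 * (J / (2 * ε)) := by
          have : ∫ w in Metric.ball z δ, ‖k w‖ ^ 2 ∂ν ≤ I2 :=
            setIntegral_le_integral hint2 (ae_of_all _ fun w => by positivity)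
          gcongr
          exact this.trans hJ2
      _ = ε * J := by field_simp; ring
  have hsum : I1 ≤ ε * J + D := by
    refine (integral_add_compl (Metric.isOpen_ball (x := z) (ε := δ)).measurableSet
      hint1).symm.trans_le ?_
    exact add_le_add hnear hfar
  have hJ3 : J ≤ L * (1 + 2 * I1) := by
    refine max_le (by nlinarith) (Real.sqrt_le_iff.2 ⟨by positivity, hmain.trans ?_⟩)
    rw [mul_pow]
    gcongr
  have hεL : L * ε = 1 / 4 := by rw [hε]; field_simp
  have hJ4 : J ≤ 2 * L * (1 + 2 * D) := by
    have : L * I1 ≤ J / 4 + L * D := by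
      calc L * I1 ≤ L * (ε * J + D) := by gcongr
        _ = (L * ε) * J + L * D := by ring
        _ = J / 4 + L * D := by rw [hεL]; ring
    nlinarith
  exact hJ2.trans (pow_le_pow_left₀ (by positivity) hJ4 2)

end Energy

/-! ### Resolvents of the perturbation: atoms and radial limits. -/

section RankOne

variable {H : Type*} [NormedAddCommGroup H] [InnerProductSpace ℂ H] [CompleteSpace H]

theorem perturb_apply (U : unitary (H →L[ℂ] H)) {φ : H} (hφ : ‖φ‖ = 1) (l : Circle) (x : H) :
    (perturb U hφ l : H →L[ℂ] H) x =
      (U : H →L[ℂ] H) x + (((l : ℂ) - 1) * ⟪φ, x⟫_ℂ) • (U : H →L[ℂ] H) φ := by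
  change (U : H →L[ℂ] H) (phase φ l x) = _
  simp only [phase, proj, add_apply, sub_apply, smul_apply, one_apply_eq_self,
    InnerProductSpace.rankOne_apply, map_add, map_sub, map_smul]
  module

theorem perturb_apply_self (U : unitary (H →L[ℂ] H)) {φ : H} (hφ : ‖φ‖ = 1) (l : Circle) :
    (perturb U hφ l : H →L[ℂ] H) φ = (l : ℂ) • (U : H →L[ℂ] H) φ := by
  rw [perturb_apply, inner_self_eq_norm_sq_to_K, hφ]
  simp only [RCLike.ofReal_one, one_pow, mul_one]
  module

theorem apply_eq_perturb (U : unitary (H →L[ℂ] H)) {φ : H} (hφ : ‖φ‖ = 1) (l : Circle) (x : H) :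
    (U : H →L[ℂ] H) x = (perturb U hφ l : H →L[ℂ] H) x +
      (((l : ℂ)⁻¹ - 1) * ⟪φ, x⟫_ℂ) • (perturb U hφ l : H →L[ℂ] H) φ := by
  have hl : (l : ℂ) ≠ 0 := Circle.coe_ne_zero l
  rw [perturb_apply_self, perturb_apply, smul_smul, add_assoc, ← add_smul]
  have : ((l : ℂ) - 1) * ⟪φ, x⟫_ℂ + ((l : ℂ)⁻¹ - 1) * ⟪φ, x⟫_ℂ * l = 0 := by
    field_simp; ring
  rw [this, zero_smul, add_zero]

/-- The function `w ↦ w / (w - ζ)` on the circle. -/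
noncomputable def momentKernel (ζ : ℂ) (hζ : ‖ζ‖ < 1) : C(Circle, ℂ) :=
  cauchyKernel ζ hζ * circleId

theorem momentKernel_apply (ζ : ℂ) (hζ : ‖ζ‖ < 1) (w : Circle) :
    momentKernel ζ hζ w = ((w : ℂ) - ζ)⁻¹ * w := rfl

theorem norm_momentKernel_apply (ζ : ℂ) (hζ : ‖ζ‖ < 1) (w : Circle) :
    ‖momentKernel ζ hζ w‖ = ‖cauchyKernel ζ hζ w‖ := by
  rw [momentKernel_apply, norm_mul, Circle.norm_coe, mul_one, cauchyKernel_apply]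

theorem circleCalc_momentKernel_apply (V : unitary (H →L[ℂ] H)) (ζ : ℂ) (hζ : ‖ζ‖ < 1) (x : H) :
    circleCalc V (momentKernel ζ hζ) x =
      circleCalc V (cauchyKernel ζ hζ) ((V : H →L[ℂ] H) x) := by
  rw [momentKernel, map_mul, circleCalc_circleId]; rfl

/-- The second resolvent identity, with `U` regarded as the perturbation of `U_λ` by the phase
`λ⁻¹`. -/
theorem circleCalc_cauchyKernel_eq (U : unitary (H →L[ℂ] H)) {φ : H} (hφ : ‖φ‖ = 1)
    (l : Circle) (ζ : ℂ) (hζ : ‖ζ‖ < 1) (x : H) :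
    circleCalc (perturb U hφ l) (cauchyKernel ζ hζ) x =
      circleCalc U (cauchyKernel ζ hζ) x +
        (((l : ℂ)⁻¹ - 1) * ⟪φ, circleCalc U (cauchyKernel ζ hζ) x⟫_ℂ) •
          circleCalc (perturb U hφ l) (momentKernel ζ hζ) φ := by
  set y := circleCalc U (cauchyKernel ζ hζ) x
  have h1 : (U : H →L[ℂ] H) y - ζ • y = x :=
    congrArg (fun T : H →L[ℂ] H => T x) (circleCalc_sub_mul_cauchyKernel U ζ hζ)
  have h2 : circleCalc (perturb U hφ l) (cauchyKernel ζ hζ)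
      ((perturb U hφ l : H →L[ℂ] H) y - ζ • y) = y :=
    congrArg (fun T : H →L[ℂ] H => T y) (circleCalc_cauchyKernel_mul_sub (perturb U hφ l) ζ hζ)
  conv_lhs => rw [← h1, apply_eq_perturb U hφ l y, add_sub_right_comm]
  rw [map_add, h2, map_smul, circleCalc_momentKernel_apply]

theorem inner_cauchyKernel_mul (U : unitary (H →L[ℂ] H)) {φ : H} (hφ : ‖φ‖ = 1)
    (l : Circle) (ζ : ℂ) (hζ : ‖ζ‖ < 1) (x : H) :
    ⟪φ, circleCalc U (cauchyKernel ζ hζ) x⟫_ℂ *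
      (1 + ((l : ℂ)⁻¹ - 1) * ∫ w, momentKernel ζ hζ w ∂(spectralMeasure (perturb U hφ l) φ)) =
      ⟪φ, circleCalc (perturb U hφ l) (cauchyKernel ζ hζ) x⟫_ℂ := by
  rw [circleCalc_cauchyKernel_eq, inner_add_right, inner_smul_right, inner_circleCalc_self]
  ring

/-- As `U_λ φ = λ U φ`, the resolvent identity makes `(U - ζ)⁻¹ U φ` equal to `c` times `(U_λ - ζ)⁻¹
U_λ φ`. Squared norms of these vectors are the two energies, because `|w / (w - ζ)| = |w - ζ|⁻¹` on
the circle. -/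
theorem exists_energy_factor (U : unitary (H →L[ℂ] H)) {φ : H} (hφ : ‖φ‖ = 1)
    (l : Circle) (ζ : ℂ) (hζ : ‖ζ‖ < 1) :
    ∃ c : ℂ, ‖c‖ * ‖1 + ((l : ℂ)⁻¹ - 1) *
        ∫ w, momentKernel ζ hζ w ∂(spectralMeasure (perturb U hφ l) φ)‖ = 1 ∧
      ‖c‖ ^ 2 * ∫ w, ‖cauchyKernel ζ hζ w‖ ^ 2 ∂(spectralMeasure (perturb U hφ l) φ) =
        ∫ w, ‖cauchyKernel ζ hζ w‖ ^ 2 ∂(spectralMeasure U φ) := by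
  have hl : (l : ℂ) ≠ 0 := Circle.coe_ne_zero l
  have h1 := circleCalc_cauchyKernel_eq U hφ l ζ hζ ((U : H →L[ℂ] H) φ)
  have h2 : circleCalc (perturb U hφ l) (cauchyKernel ζ hζ) ((U : H →L[ℂ] H) φ) =
      (l : ℂ)⁻¹ • circleCalc (perturb U hφ l) (momentKernel ζ hζ) φ := by
    rw [circleCalc_momentKernel_apply, perturb_apply_self, map_smul, smul_smul,
      inv_mul_cancel₀ hl, one_smul]
  have h3 := inner_cauchyKernel_mul U hφ l ζ hζ ((U : H →L[ℂ] H) φ)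
  rw [h2, inner_smul_right, inner_circleCalc_self] at h3
  rw [h2, ← circleCalc_momentKernel_apply] at h1
  rw [← circleCalc_momentKernel_apply] at h3
  set M := ∫ w, momentKernel ζ hζ w ∂(spectralMeasure (perturb U hφ l) φ)
  set m := ⟪φ, circleCalc U (momentKernel ζ hζ) φ⟫_ℂ
  refine ⟨(l : ℂ)⁻¹ - ((l : ℂ)⁻¹ - 1) * m, ?_, ?_⟩
  · rw [← norm_mul]
    have : ((l : ℂ)⁻¹ - ((l : ℂ)⁻¹ - 1) * m) * (1 + ((l : ℂ)⁻¹ - 1) * M) = (l : ℂ)⁻¹ := by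
      linear_combination (1 - (l : ℂ)⁻¹) * h3
    rw [this, norm_inv, Circle.norm_coe, inv_one]
  · simp_rw [← norm_momentKernel_apply]
    rw [← norm_circleCalc_sq, ← norm_circleCalc_sq, ← mul_pow, ← norm_smul, sub_smul, h1,
      add_sub_cancel_right]

theorem radial_energy_le (U : unitary (H →L[ℂ] H)) (φ : H) {z : Circle}
    (hz : simonWolffG U φ z < ∞) (r : ℝ) (h0 : 0 ≤ r) (h1 : r < 1) :
    ∫ w, ‖cauchyKernel (r * z) (norm_radial_lt_one z h0 h1) w‖ ^ 2 ∂(spectralMeasure U φ) ≤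
      4 * (simonWolffG U φ z).toReal := by
  rw [integral_eq_lintegral_of_nonneg_ae (ae_of_all _ fun w => by positivity)
    (by fun_prop)]
  refine ENNReal.toReal_le_of_le_ofReal (by positivity) ?_
  rw [ENNReal.ofReal_mul (by positivity), ENNReal.ofReal_toReal hz.ne, simonWolffG,
    ← lintegral_const_mul _ (by fun_prop)]
  refine lintegral_mono fun w => ?_
  have hne := circle_coe_sub_ne_zero (norm_radial_lt_one z h0 h1) w
  have h2 := norm_sub_le_two_mul_norm_sub_radial z w h0 h1
  rw [cauchyKernel_apply, ← enorm_inv_sq_eq hne]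
  rw [norm_sub_rev] at h2
  have h3 : ‖(z : ℂ) - w‖ₑ ≤ 2 * ‖(w : ℂ) - r * z‖ₑ := by
    rw [← ofReal_norm, ← ofReal_norm, ← ENNReal.ofReal_ofNat 2,
      ← ENNReal.ofReal_mul (by norm_num)]
    exact ENNReal.ofReal_le_ofReal h2
  have h4 : (4 : ℝ≥0∞)⁻¹ * (‖(w : ℂ) - r * z‖ₑ ^ 2)⁻¹ ≤ (‖(z : ℂ) - w‖ₑ ^ 2)⁻¹ := by
    rw [← ENNReal.mul_inv (by simp) (by simp), ENNReal.inv_le_inv]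
    calc ‖(z : ℂ) - w‖ₑ ^ 2 ≤ (2 * ‖(w : ℂ) - r * z‖ₑ) ^ 2 := by gcongr
      _ = 4 * ‖(w : ℂ) - r * z‖ₑ ^ 2 := by ring
  calc (‖(w : ℂ) - r * z‖ₑ ^ 2)⁻¹ = 4 * ((4 : ℝ≥0∞)⁻¹ * (‖(w : ℂ) - r * z‖ₑ ^ 2)⁻¹) := by
        rw [← mul_assoc, ENNReal.mul_inv_cancel (by simp) (by simp), one_mul]
    _ ≤ ENNReal.ofReal 4 * (‖(z : ℂ) - w‖ₑ ^ 2)⁻¹ := by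
        rw [ENNReal.ofReal_ofNat]; gcongr

/-- The factor relating the two energies is at most `(1 + 2 ∫ |w - rz|⁻¹ dν)²`, since `|λ⁻¹ - 1| ≤
2`; this is the hypothesis of the bootstrap. -/
theorem energy_perturb_lt_top (U : unitary (H →L[ℂ] H)) {φ : H} (hφ : ‖φ‖ = 1)
    (l : Circle) {z : Circle} (hz : simonWolffG U φ z < ∞)
    (hz0 : spectralMeasure (perturb U hφ l) φ {z} = 0) :
    ∫⁻ w, (‖(z : ℂ) - (w : ℂ)‖ₑ ^ 2)⁻¹ ∂(spectralMeasure (perturb U hφ l) φ) < ∞ := by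
  refine energy_lt_top_of_radial_bound hz0 (K := 4 * (simonWolffG U φ z).toReal)
    fun r h0 h1 => ?_
  set ν := spectralMeasure (perturb U hφ l) φ
  set hζ := norm_radial_lt_one z h0 h1
  obtain ⟨c, hc1, hc2⟩ := exists_energy_factor U hφ l (r * z) hζ
  set M := ∫ w, momentKernel (r * z) hζ w ∂ν
  set I1 := ∫ w, ‖cauchyKernel (r * z) hζ w‖ ∂ν
  have hM : ‖M‖ ≤ I1 := by
    refine (norm_integral_le_integral_norm _).trans_eq ?_
    simp_rw [norm_momentKernel_apply]; rfl
  have hl : ‖(l : ℂ)⁻¹ - 1‖ ≤ 2 := by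
    refine (norm_sub_le _ _).trans_eq ?_
    rw [norm_inv, Circle.norm_coe]; norm_num
  have hI : ‖1 + ((l : ℂ)⁻¹ - 1) * M‖ ≤ 1 + 2 * I1 := by
    refine (norm_add_le _ _).trans ?_
    rw [norm_one, norm_mul]
    gcongr
  have hG := radial_energy_le U φ hz r h0 h1
  rw [← hc2] at hG
  set I2 := ∫ w, ‖cauchyKernel (r * z) hζ w‖ ^ 2 ∂ν
  calc I2 = (‖c‖ ^ 2 * I2) * ‖1 + ((l : ℂ)⁻¹ - 1) * M‖ ^ 2 := by
        rw [mul_right_comm, ← mul_pow, hc1, one_pow, one_mul]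
    _ ≤ 4 * (simonWolffG U φ z).toReal * (1 + 2 * I1) ^ 2 := by
        gcongr

/-- Almost every point at which `G` is finite is an atom of the perturbed spectral measure. -/
theorem ae_atom_of_ae_simonWolffG_lt_top (U : unitary (H →L[ℂ] H)) {φ : H} (hφ : ‖φ‖ = 1)
    (l : Circle) (h : ∀ᵐ z ∂(spectralMeasure (perturb U hφ l) φ), simonWolffG U φ z < ∞) :
    ∀ᵐ z ∂(spectralMeasure (perturb U hφ l) φ),
      spectralMeasure (perturb U hφ l) φ {z} ≠ 0 := by
  filter_upwards [h, ae_energy_eq_top (spectralMeasure (perturb U hφ l) φ)] with z hz htop hz0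
  exact (energy_perturb_lt_top U hφ l hz hz0).ne htop

/-- Dominated convergence: `(1 - r) / |w - rz| ≤ 1`, and `(1 - r) / (w - rz)` tends to `z⁻¹` at `w =
z` and to `0` elsewhere. -/
theorem tendsto_one_sub_mul_integral_cauchyKernel {ν : Measure Circle} {g : Circle → ℂ}
    (hg : Integrable g ν) (z : Circle) :
    Tendsto (fun r : ℝ => ((1 - r : ℝ) : ℂ) * ∫ w, ((w : ℂ) - r * z)⁻¹ * g w ∂ν) (𝓝[<] 1)
      (𝓝 (ν.real {z} * ((z : ℂ)⁻¹ * g z))) := by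
  have hev : ∀ᶠ r : ℝ in 𝓝[<] 1, 0 ≤ r ∧ r < 1 := by
    filter_upwards [Ioo_mem_nhdsLT (zero_lt_one (α := ℝ))] with r hr
    exact ⟨hr.1.le, hr.2⟩
  have hlim : ∫ w, ({z} : Set Circle).indicator (fun w => (w : ℂ)⁻¹ * g w) w ∂ν =
      ν.real {z} * ((z : ℂ)⁻¹ * g z) := by
    rw [integral_indicator (measurableSet_singleton z), integral_singleton]
    simp
  rw [← hlim]
  simp_rw [← integral_const_mul]
  refine tendsto_integral_filter_of_dominated_convergence (fun w => ‖g w‖) ?_ ?_ hg.norm ?_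
  · filter_upwards with r
    refine AEStronglyMeasurable.const_mul (AEStronglyMeasurable.mul ?_ hg.1) _
    exact (Measurable.inv (by fun_prop)).aestronglyMeasurable
  · filter_upwards [hev] with r hr
    refine ae_of_all _ fun w => ?_
    have h1 : 1 - r ≤ ‖(w : ℂ) - r * z‖ := by
      have := norm_sub_norm_le (w : ℂ) (r * z)
      rwa [norm_mul, Circle.norm_coe, Circle.norm_coe, Complex.norm_real, Real.norm_eq_abs,
        abs_of_nonneg hr.1, mul_one] at this
    rw [← mul_assoc, norm_mul, norm_mul, norm_inv, Complex.norm_real, Real.norm_eq_abs,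
      abs_of_pos (by linarith [hr.2])]
    refine mul_le_of_le_one_left (norm_nonneg _) ?_
    rw [← div_eq_mul_inv]
    exact div_le_one_of_le₀ h1 (norm_nonneg _)
  · refine ae_of_all _ fun w => ?_
    by_cases hw : w = z
    · subst hw
      rw [indicator_of_mem (mem_singleton w)]
      refine tendsto_const_nhds.congr' ?_
      filter_upwards [hev] with r hr
      have h1 : ((1 - r : ℝ) : ℂ) ≠ 0 := by exact_mod_cast (by linarith [hr.2] : 1 - r ≠ 0)
      have h2 : (w : ℂ) - r * w = ((1 - r : ℝ) : ℂ) * w := by push_cast; ring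
      rw [h2, mul_inv, mul_assoc, mul_inv_cancel_left₀ h1]
    · rw [indicator_of_notMem (by simpa using hw)]
      have hne : (w : ℂ) - ((1 : ℝ) : ℂ) * z ≠ 0 := by
        rw [Complex.ofReal_one, one_mul, sub_ne_zero]
        exact fun h => hw (Circle.ext h)
      have hc : ContinuousAt (fun r : ℝ => ((1 - r : ℝ) : ℂ) *
          (((w : ℂ) - r * z)⁻¹ * g w)) 1 := by
        refine ContinuousAt.mul (by fun_prop) (ContinuousAt.mul (ContinuousAt.inv₀ ?_ hne)
          continuousAt_const)
        fun_prop
      have := hc.tendsto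
      simp only [sub_self, Complex.ofReal_zero, zero_mul] at this
      exact this.mono_left nhdsWithin_le_nhds

theorem inner_cayley_of_orthogonal (U : unitary (H →L[ℂ] H)) {φ ψ : H} (hψ : ⟪φ, ψ⟫_ℂ = 0)
    (ζ : ℂ) (hζ : ‖ζ‖ < 1) :
    ⟪φ, cayley U ζ ψ⟫_ℂ = 2 * ζ * ⟪φ, circleCalc U (cauchyKernel ζ hζ) ψ⟫_ℂ := by
  have h1 : cayley U ζ = 1 + (2 * ζ) • circleCalc U (cauchyKernel ζ hζ) := by
    rw [cayley, inverse_sub_eq U ζ hζ]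
    have : (U : H →L[ℂ] H) + ζ • 1 = ((U : H →L[ℂ] H) - ζ • 1) + (2 * ζ) • 1 := by module
    rw [this, add_mul, circleCalc_sub_mul_cauchyKernel, smul_mul_assoc, one_mul]
  rw [h1, add_apply, smul_apply, one_apply_eq_self, inner_add_right, hψ, zero_add,
    inner_smul_right]

/-- At an atom of the spectral measure of `U_λ`, `λ ≠ 1`, the radial limit exists and is given by
the spectral representative of `ψ`. -/
theorem tendsto_inner_cayley_of_atom (U : unitary (H →L[ℂ] H)) {φ ψ : H} (hφ : ‖φ‖ = 1)
    (hψ : ⟪φ, ψ⟫_ℂ = 0) {l : Circle} (hl : l ≠ 1) {g : Circle → ℂ}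
    (hg : Integrable g (spectralMeasure (perturb U hφ l) φ))
    (hrep : ∀ h : C(Circle, ℂ), ⟪φ, circleCalc (perturb U hφ l) h ψ⟫_ℂ =
      ∫ w, h w * g w ∂(spectralMeasure (perturb U hφ l) φ))
    {z : Circle} (hz : spectralMeasure (perturb U hφ l) φ {z} ≠ 0) :
    Tendsto (fun r : ℝ => ⟪φ, cayley U ((r : ℂ) * z) ψ⟫_ℂ) (𝓝[<] 1)
      (𝓝 (2 * g z / ((l : ℂ)⁻¹ - 1))) := by
  set ν := spectralMeasure (perturb U hφ l) φ
  have hm : (ν.real {z} : ℂ) ≠ 0 := by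
    rw [Ne, Complex.ofReal_eq_zero, measureReal_eq_zero_iff]; exact hz
  have hz' : (z : ℂ) ≠ 0 := Circle.coe_ne_zero z
  have hl' : (l : ℂ)⁻¹ - 1 ≠ 0 := by
    rw [sub_ne_zero, Ne, inv_eq_one]
    exact fun h => hl (Circle.ext h)
  have hid : Integrable (fun w : Circle => (w : ℂ)) ν :=
    circleId.integrable_of_isFiniteMeasure ν
  have hr : Tendsto (fun r : ℝ => (r : ℂ)) (𝓝[<] 1) (𝓝 1) :=
    (Complex.continuous_ofReal.tendsto' 1 1 Complex.ofReal_one).mono_left nhdsWithin_le_nhds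
  have hr' : Tendsto (fun r : ℝ => ((1 - r : ℝ) : ℂ)) (𝓝[<] 1) (𝓝 0) := by
    simpa using hr.const_sub 1
  -- Numerator and denominator of the quotient formula are both multiplied by `1 - r`; each limit
  -- then carries the factor `ν {z}`, nonzero at an atom.
  have h1 := tendsto_one_sub_mul_integral_cauchyKernel hg z
  have h2 := tendsto_one_sub_mul_integral_cauchyKernel hid z
  rw [inv_mul_cancel₀ hz', mul_one] at h2
  have hden : Tendsto (fun r : ℝ => ((1 - r : ℝ) : ℂ) + ((l : ℂ)⁻¹ - 1) *
      (((1 - r : ℝ) : ℂ) * ∫ w, ((w : ℂ) - r * z)⁻¹ * (w : ℂ) ∂ν)) (𝓝[<] 1)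
      (𝓝 (((l : ℂ)⁻¹ - 1) * ν.real {z})) := by
    simpa using hr'.add (h2.const_mul ((l : ℂ)⁻¹ - 1))
  have hne : ((l : ℂ)⁻¹ - 1) * (ν.real {z} : ℂ) ≠ 0 := mul_ne_zero hl' hm
  have hlim := (((hr.const_mul 2).mul_const (z : ℂ)).mul h1).div hden hne
  have heq : 2 * 1 * (z : ℂ) * (ν.real {z} * ((z : ℂ)⁻¹ * g z)) /
      (((l : ℂ)⁻¹ - 1) * ν.real {z}) = 2 * g z / ((l : ℂ)⁻¹ - 1) := by
    field_simp
  rw [heq] at hlim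
  refine hlim.congr' ?_
  filter_upwards [Ioo_mem_nhdsLT (zero_lt_one (α := ℝ)), hden.eventually_ne hne] with r hr01 hdr
  have hζ := norm_radial_lt_one z hr01.1.le hr01.2
  have h3 := inner_cauchyKernel_mul U hφ l (r * z) hζ ψ
  rw [hrep] at h3
  rw [inner_cayley_of_orthogonal U hψ _ hζ, Pi.div_apply]
  refine (div_eq_iff hdr).2 ?_
  change _ * (1 + ((l : ℂ)⁻¹ - 1) * ∫ w, ((w : ℂ) - r * z)⁻¹ * (w : ℂ) ∂ν) =
    ∫ w, ((w : ℂ) - r * z)⁻¹ * g w ∂ν at h3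
  rw [← h3]
  ring

end RankOne

/-! ### Spectral averaging over the coupling `λ`. -/

section Averaging

variable {H : Type*} [NormedAddCommGroup H] [InnerProductSpace ℂ H] [CompleteSpace H]

theorem integral_arcMeasure (f : C(Circle, ℂ)) :
    ∫ w, f w ∂arcMeasure = ((1 / (2 * Real.pi) : ℝ) : ℂ) *
      ∫ θ in (0 : ℝ)..(2 * Real.pi), f (Circle.exp θ) := by
  have hpi := Real.two_pi_pos
  rw [arcMeasure, integral_smul_measure,
    integral_map Circle.exp.continuous.aemeasurable f.continuous.aestronglyMeasurable,
    intervalIntegral.integral_of_le hpi.le, ENNReal.toReal_ofReal (by positivity)]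
  exact Complex.real_smul

instance : IsProbabilityMeasure (arcMeasure) := by
  have hpi := Real.two_pi_pos
  constructor
  rw [arcMeasure, Measure.smul_apply, Measure.map_apply Circle.exp.continuous.measurable .univ,
    preimage_univ, Measure.restrict_apply .univ, univ_inter, Real.volume_Ioc, smul_eq_mul, sub_zero,
    ← ENNReal.ofReal_mul (by positivity), one_div, inv_mul_cancel₀ hpi.ne', ENNReal.ofReal_one]

theorem arcMeasure_singleton_one : arcMeasure {(1 : Circle)} = 0 := by
  rw [arcMeasure, Measure.smul_apply,
    Measure.map_apply Circle.exp.continuous.measurable (measurableSet_singleton 1), smul_eq_mul]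
  refine mul_eq_zero_of_right _ ?_
  refine ((countable_range fun k : ℤ => (k : ℝ) * (2 * Real.pi)).mono ?_).measure_zero _
  intro θ hθ
  rw [mem_preimage, mem_singleton_iff, ← Circle.exp_zero, Circle.exp_eq_exp] at hθ
  obtain ⟨k, hk⟩ := hθ
  exact ⟨k, by rw [hk, zero_add]⟩

theorem integral_arcMeasure_circlePow {n : ℤ} (hn : n ≠ 0) :
    ∫ w, circlePow n w ∂arcMeasure = 0 := by
  have hc : (n : ℂ) * Complex.I ≠ 0 := mul_ne_zero (by exact_mod_cast hn) Complex.I_ne_zero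
  have h (θ : ℝ) : circlePow n (Circle.exp θ) = Complex.exp ((n : ℂ) * Complex.I * θ) := by
    rw [circlePow_apply, Circle.coe_zpow, Circle.coe_exp, ← Complex.exp_int_mul]
    congr 1; ring
  rw [integral_arcMeasure]
  simp_rw [h]
  rw [integral_exp_mul_complex hc]
  have h1 : (n : ℂ) * Complex.I * ((2 * Real.pi : ℝ) : ℂ) = n * (2 * Real.pi * Complex.I) := by
    push_cast; ring
  rw [h1, Complex.exp_int_mul_two_pi_mul_I]
  simp

/-- Each factor `U_λ` is affine in `λ`. -/
theorem exists_polynomial_inner_perturb_pow (U : unitary (H →L[ℂ] H)) {φ : H} (hφ : ‖φ‖ = 1)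
    (n : ℕ) (y x : H) : ∃ p : Polynomial ℂ, ∀ l : Circle,
      ⟪y, (perturb U hφ l : H →L[ℂ] H) ^ n • x⟫_ℂ = p.eval (l : ℂ) := by
  induction n generalizing x with
  | zero => exact ⟨Polynomial.C ⟪y, x⟫_ℂ, fun l => by simp⟩
  | succ n ih =>
    obtain ⟨p, hp⟩ := ih ((U : H →L[ℂ] H) x)
    obtain ⟨q, hq⟩ := ih ((U : H →L[ℂ] H) φ)
    refine ⟨p + (Polynomial.X - 1) * Polynomial.C ⟪φ, x⟫_ℂ * q, fun l => ?_⟩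
    rw [pow_succ, mul_smul]
    change ⟪y, (perturb U hφ l : H →L[ℂ] H) ^ n • (perturb U hφ l : H →L[ℂ] H) x⟫_ℂ = _
    rw [perturb_apply, smul_add, smul_comm, inner_add_right, inner_smul_right, hp, hq]
    simp

theorem integral_eval_mul_arcMeasure (p : Polynomial ℂ) :
    ∫ l : Circle, (l : ℂ) * p.eval (l : ℂ) ∂arcMeasure = 0 := by
  have hcont (p : Polynomial ℂ) : Integrable (fun l : Circle => (l : ℂ) * p.eval (l : ℂ))
      arcMeasure :=
    ContinuousMap.integrable_of_isFiniteMeasure _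
      (⟨fun l => (l : ℂ) * p.eval (l : ℂ), by fun_prop⟩ : C(Circle, ℂ))
  induction p using Polynomial.induction_on' with
  | add p q hp hq =>
    simp_rw [Polynomial.eval_add, mul_add]
    rw [integral_add (hcont p) (hcont q), hp, hq, add_zero]
  | monomial n a =>
    have h (l : Circle) : (l : ℂ) * (Polynomial.monomial n a).eval (l : ℂ) =
        a * circlePow (n + 1 : ℕ) l := by
      rw [Polynomial.eval_monomial, circlePow_natCast]
      simp; ring
    simp_rw [h]
    rw [integral_const_mul, integral_arcMeasure_circlePow (by positivity), mul_zero]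

theorem spectralMeasure_isProbabilityMeasure (V : unitary (H →L[ℂ] H)) {φ : H} (hφ : ‖φ‖ = 1) :
    IsProbabilityMeasure (spectralMeasure V φ) := by
  have h := norm_circleCalc_sq V φ 1
  simp only [map_one, one_apply_eq_self, ContinuousMap.one_apply, norm_one, one_pow, integral_const,
    smul_eq_mul, mul_one, hφ] at h
  exact ⟨by rw [← ENNReal.toReal_eq_one_iff]; exact h.symm⟩

/-- For `n ≥ 1` the rightmost factor acts by `U_λ φ = λ U φ`, so the moment is `λ` times a
polynomial in `λ` and has mean zero, as does `wⁿ`. -/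
theorem average_circlePow_natCast (U : unitary (H →L[ℂ] H)) {φ : H} (hφ : ‖φ‖ = 1) (n : ℕ) :
    Continuous (fun l => ∫ w, circlePow n w ∂(spectralMeasure (perturb U hφ l) φ)) ∧
      ∫ l, ∫ w, circlePow n w ∂(spectralMeasure (perturb U hφ l) φ) ∂arcMeasure =
        ∫ w, circlePow n w ∂arcMeasure := by
  have hmom (l : Circle) : ∫ w, circlePow n w ∂(spectralMeasure (perturb U hφ l) φ) =
      ⟪φ, (perturb U hφ l : H →L[ℂ] H) ^ n • φ⟫_ℂ := by
    rw [← inner_circleCalc_self, circlePow_natCast, map_pow, circleCalc_circleId]; rfl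
  simp_rw [hmom]
  refine ⟨?_, ?_⟩
  · obtain ⟨p, hp⟩ := exists_polynomial_inner_perturb_pow U hφ n φ φ
    simp_rw [hp]
    fun_prop
  · rcases n with _ | n
    · simp [hφ]
    · obtain ⟨p, hp⟩ := exists_polynomial_inner_perturb_pow U hφ n φ ((U : H →L[ℂ] H) φ)
      have h (l : Circle) : ⟪φ, (perturb U hφ l : H →L[ℂ] H) ^ (n + 1) • φ⟫_ℂ =
          (l : ℂ) * p.eval (l : ℂ) := by
        rw [pow_succ, mul_smul]
        change ⟪φ, (perturb U hφ l : H →L[ℂ] H) ^ n • (perturb U hφ l : H →L[ℂ] H) φ⟫_ℂ = _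
        rw [perturb_apply_self, smul_comm, inner_smul_right, hp]
      simp_rw [h]
      rw [integral_eval_mul_arcMeasure, integral_arcMeasure_circlePow (by positivity)]

theorem average_circlePow (U : unitary (H →L[ℂ] H)) {φ : H} (hφ : ‖φ‖ = 1) (n : ℤ) :
    Continuous (fun l => ∫ w, circlePow n w ∂(spectralMeasure (perturb U hφ l) φ)) ∧
      ∫ l, ∫ w, circlePow n w ∂(spectralMeasure (perturb U hφ l) φ) ∂arcMeasure =
        ∫ w, circlePow n w ∂arcMeasure := by
  obtain ⟨n, rfl | rfl⟩ := n.eq_nat_or_neg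
  · exact average_circlePow_natCast U hφ n
  · have hconj (μ : Measure Circle) : ∫ w, circlePow (-n) w ∂μ =
        (starRingEnd ℂ) (∫ w, circlePow n w ∂μ) := by
      rw [← integral_conj, circlePow_neg]; rfl
    obtain ⟨h1, h2⟩ := average_circlePow_natCast U hφ n
    simp_rw [hconj]
    exact ⟨Complex.continuous_conj.comp h1, by rw [integral_conj, h2]⟩

theorem closure_span_circlePow :
    (Submodule.span ℂ (range circlePow)).topologicalClosure = ⊤ := by
  rw [eq_top_iff]
  intro f _
  let e : AddCircle (1 : ℝ) ≃ₜ Circle := AddCircle.homeomorphCircle one_ne_zero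
  let E : C(AddCircle (1 : ℝ), ℂ) →L[ℂ] C(Circle, ℂ) :=
    ContinuousMap.compCLM ℂ ℂ (e.symm : C(Circle, AddCircle (1 : ℝ)))
  have hf : f = E (f.comp (e : C(AddCircle (1 : ℝ), Circle))) := by
    ext w; simp [E]
  have hmem : f.comp (e : C(AddCircle (1 : ℝ), Circle)) ∈
      closure (Submodule.span ℂ (range (fourier (T := 1))) : Set C(AddCircle (1 : ℝ), ℂ)) := by
    rw [← Submodule.topologicalClosure_coe, span_fourier_closure_eq_top]; trivial
  rw [hf]
  refine map_mem_closure E.continuous hmem ?_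
  intro g hg
  have hle : Submodule.span ℂ (range (fourier (T := 1))) ≤
      (Submodule.span ℂ (range circlePow)).comap E.toLinearMap := by
    rw [Submodule.span_le]
    rintro _ ⟨n, rfl⟩
    refine Submodule.subset_span ⟨n, ?_⟩
    ext w
    have : w = AddCircle.toCircle (e.symm w) := by
      rw [← AddCircle.homeomorphCircle_apply one_ne_zero]; exact (e.apply_symm_apply w).symm
    change ((w ^ n : Circle) : ℂ) = fourier n (e.symm w)
    rw [fourier_apply, AddCircle.toCircle_zsmul, ← this]
  exact hle hg

/-- The functions with both properties form a closed subspace containing the powers of `w`.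
Continuity in `λ` is carried along because it provides the integrability needed for sums and
survives uniform limits. -/
theorem average_continuousMap (U : unitary (H →L[ℂ] H)) {φ : H} (hφ : ‖φ‖ = 1)
    (f : C(Circle, ℂ)) :
    Continuous (fun l => ∫ w, f w ∂(spectralMeasure (perturb U hφ l) φ)) ∧
      ∫ l, ∫ w, f w ∂(spectralMeasure (perturb U hφ l) φ) ∂arcMeasure =
        ∫ w, f w ∂arcMeasure := by
  have hprob (l : Circle) : IsProbabilityMeasure (spectralMeasure (perturb U hφ l) φ) :=
    spectralMeasure_isProbabilityMeasure _ hφ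
  have hdist (μ : Measure Circle) [IsProbabilityMeasure μ] (f g : C(Circle, ℂ)) :
      dist (∫ w, f w ∂μ) (∫ w, g w ∂μ) ≤ dist f g := by
    rw [dist_eq_norm, dist_eq_norm, ← integral_sub (f.integrable_of_isFiniteMeasure μ)
      (g.integrable_of_isFiniteMeasure μ)]
    refine (norm_integral_le_of_norm_le_const (C := ‖f - g‖)
      (ae_of_all _ fun w => (f - g).norm_coe_le_norm w)).trans_eq ?_
    simp
  let Q : C(Circle, ℂ) → Circle → ℂ := fun f l => ∫ w, f w ∂(spectralMeasure (perturb U hφ l) φ)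
  let S : Submodule ℂ C(Circle, ℂ) :=
    { carrier := {f | Continuous (Q f) ∧ ∫ l, Q f l ∂arcMeasure = ∫ w, f w ∂arcMeasure}
      zero_mem' := by simp [Q, continuous_const]
      add_mem' := by
        rintro f g ⟨hf1, hf2⟩ ⟨hg1, hg2⟩
        have hadd : Q (f + g) = Q f + Q g := by
          ext l
          exact integral_add (f.integrable_of_isFiniteMeasure _) (g.integrable_of_isFiniteMeasure _)
        refine ⟨hadd ▸ hf1.add hg1, ?_⟩
        rw [hadd]
        refine (integral_add (ContinuousMap.integrable_of_isFiniteMeasure _ ⟨_, hf1⟩)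
          (ContinuousMap.integrable_of_isFiniteMeasure _ ⟨_, hg1⟩)).trans ?_
        refine (congrArg₂ (· + ·) hf2 hg2).trans ?_
        exact (integral_add (f.integrable_of_isFiniteMeasure _)
          (g.integrable_of_isFiniteMeasure _)).symm
      smul_mem' := by
        rintro c f ⟨hf1, hf2⟩
        have hsmul : Q (c • f) = c • Q f := by
          ext l
          exact integral_const_mul _ _
        refine ⟨hsmul ▸ hf1.const_smul c, ?_⟩
        rw [hsmul]
        refine (integral_const_mul _ _).trans ?_
        rw [hf2]
        exact (integral_const_mul _ _).symm }
  have hS : Submodule.span ℂ (range circlePow) ≤ S := by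
    rw [Submodule.span_le]
    rintro _ ⟨n, rfl⟩
    exact average_circlePow U hφ n
  have hclosed : IsClosed (S : Set C(Circle, ℂ)) := by
    refine isClosed_of_closure_subset fun f hf => ?_
    obtain ⟨g, hgS, hgf⟩ := mem_closure_iff_seq_limit.1 hf
    have hunif : TendstoUniformly (fun n => Q (g n)) (Q f) atTop := by
      rw [Metric.tendstoUniformly_iff]
      intro ε hε
      filter_upwards [Metric.tendsto_nhds.1 hgf ε hε] with n hn l
      exact (hdist _ _ _).trans_lt (by rwa [dist_comm])
    have hQf : Continuous (Q f) :=
      hunif.continuous (Frequently.of_forall fun n => (hgS n).1)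
    have hQmap : Tendsto (fun n => (⟨Q (g n), (hgS n).1⟩ : C(Circle, ℂ))) atTop (𝓝 ⟨Q f, hQf⟩) :=
      ContinuousMap.tendsto_iff_tendstoUniformly.2 hunif
    have hcont : Continuous fun f : C(Circle, ℂ) => ∫ w, f w ∂arcMeasure :=
      (LipschitzWith.of_dist_le_mul (K := 1) fun f g => by
        simpa using hdist arcMeasure f g).continuous
    refine ⟨hQf, tendsto_nhds_unique ((hcont.tendsto _).comp hQmap) ?_⟩
    refine ((hcont.tendsto _).comp hgf).congr fun n => ?_
    exact (hgS n).2.symm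
  have : f ∈ (Submodule.span ℂ (range circlePow)).topologicalClosure := by
    rw [closure_span_circlePow]; trivial
  exact Submodule.topologicalClosure_minimal _ hS hclosed this

theorem integral_ofReal_nnreal (μ : Measure Circle) (f : BoundedContinuousFunction Circle NNReal) :
    ∫ w, (((f w : ℝ)) : ℂ) ∂μ = (((∫⁻ w, f w ∂μ).toReal : ℝ) : ℂ) := by
  rw [integral_complex_ofReal]
  congr 1
  rw [integral_eq_lintegral_of_nonneg_ae (ae_of_all _ fun w => by positivity) (by fun_prop)]
  simp

theorem average_lintegral (U : unitary (H →L[ℂ] H)) {φ : H} (hφ : ‖φ‖ = 1)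
    (f : BoundedContinuousFunction Circle NNReal) :
    Measurable (fun l => ∫⁻ w, f w ∂(spectralMeasure (perturb U hφ l) φ)) ∧
      ∫⁻ l, ∫⁻ w, f w ∂(spectralMeasure (perturb U hφ l) φ) ∂arcMeasure =
        ∫⁻ w, f w ∂arcMeasure := by
  obtain ⟨h1, h2⟩ := average_continuousMap U hφ ⟨fun w => ((f w : ℝ) : ℂ), by fun_prop⟩
  simp only [ContinuousMap.coe_mk, integral_ofReal_nnreal] at h1 h2
  have hfin (μ : Measure Circle) [IsFiniteMeasure μ] : ∫⁻ w, f w ∂μ ≠ ∞ :=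
    (f.lintegral_lt_top_of_nnreal μ).ne
  have h3 (l : Circle) : ∫⁻ w, f w ∂(spectralMeasure (perturb U hφ l) φ) =
      ENNReal.ofReal (∫⁻ w, f w ∂(spectralMeasure (perturb U hφ l) φ)).toReal :=
    (ENNReal.ofReal_toReal (hfin _)).symm
  have h4 : Continuous fun l =>
      (∫⁻ w, f w ∂(spectralMeasure (perturb U hφ l) φ)).toReal := by
    exact Complex.continuous_re.comp h1
  refine ⟨?_, ?_⟩
  · rw [funext h3]
    exact h4.measurable.ennreal_ofReal
  · have hint : Integrable (fun l =>
        (∫⁻ w, f w ∂(spectralMeasure (perturb U hφ l) φ)).toReal) arcMeasure :=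
      ContinuousMap.integrable_of_isFiniteMeasure _ ⟨_, h4⟩
    rw [integral_complex_ofReal] at h2
    rw [lintegral_congr h3, ← ofReal_integral_eq_lintegral_ofReal hint
      (ae_of_all _ fun _ => ENNReal.toReal_nonneg), Complex.ofReal_injective h2,
      ENNReal.ofReal_toReal (hfin _)]

/-- Closed sets form a generating π-system, and their indicators are limits of continuous functions,
whose integrals are measurable in `λ`. -/
theorem measurable_spectralMeasure_perturb (U : unitary (H →L[ℂ] H)) {φ : H} (hφ : ‖φ‖ = 1) :
    Measurable fun l => spectralMeasure (perturb U hφ l) φ := by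
  have hprob (l : Circle) : IsProbabilityMeasure (spectralMeasure (perturb U hφ l) φ) :=
    spectralMeasure_isProbabilityMeasure _ hφ
  refine Measurable.measure_of_isPiSystem_of_isProbabilityMeasure
    borel_eq_generateFrom_isClosed isPiSystem_isClosed fun s hs => ?_
  refine measurable_of_tendsto_metrizable
    (fun n => (average_lintegral U hφ (hs.apprSeq n)).1) ?_
  rw [tendsto_pi_nhds]
  exact fun l => HasOuterApproxClosed.tendsto_lintegral_apprSeq hs _

/-- Spectral averaging: the average of the spectral measures of `U_λ` over `λ` is the normalized
Lebesgue measure. -/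
theorem bind_spectralMeasure_perturb (U : unitary (H →L[ℂ] H)) {φ : H} (hφ : ‖φ‖ = 1) :
    arcMeasure.bind (fun l => spectralMeasure (perturb U hφ l) φ) = arcMeasure := by
  have hmeas := (measurable_spectralMeasure_perturb U hφ).aemeasurable (μ := arcMeasure)
  refine (ext_of_forall_lintegral_eq_of_IsFiniteMeasure fun f => ?_).symm
  rw [Measure.lintegral_bind hmeas (by fun_prop), (average_lintegral U hφ f).2]

theorem ae_ae_spectralMeasure_perturb (U : unitary (H →L[ℂ] H)) {φ : H} (hφ : ‖φ‖ = 1)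
    {p : Circle → Prop} (h : ∀ᵐ z ∂arcMeasure, p z) :
    ∀ᵐ l ∂arcMeasure, ∀ᵐ z ∂(spectralMeasure (perturb U hφ l) φ), p z :=
  Measure.ae_ae_of_ae_bind (measurable_spectralMeasure_perturb U hφ).aemeasurable
    (by rwa [bind_spectralMeasure_perturb])

end Averaging

/-! ### Interpolation of moments. -/

section Interpolation

/-- Interpolation of the first moment between the moments of order `p < 1` and `2`. -/
theorem integral_norm_le_rpow_mul_rpow {X E : Type*} [MeasurableSpace X] [NormedAddCommGroup E]
    {ν : Measure X} [IsFiniteMeasure ν] {g : X → E} (hg : MemLp g 2 ν) {p : ℝ} (hp0 : 0 < p)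
    (hp1 : p < 1) :
    ∫ w, ‖g w‖ ∂ν ≤ (∫ w, ‖g w‖ ^ p ∂ν) ^ (1 / (2 - p)) *
      (∫ w, ‖g w‖ ^ 2 ∂ν) ^ (1 / ((2 - p) / (1 - p))) := by
  have h2p : 0 < 2 - p := by linarith
  have h1p : 0 < 1 - p := by linarith
  have hconj : (2 - p).HolderConjugate ((2 - p) / (1 - p)) := by
    rw [Real.holderConjugate_iff]
    refine ⟨by linarith, ?_⟩
    field_simp
    ring
  have hmem {q s : ℝ} (hq : 0 < q) (hs : 0 < s) (hqs : q * s ≤ 2) :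
      MemLp (fun w => ‖g w‖ ^ q) (ENNReal.ofReal s) ν := by
    have hmeas : AEStronglyMeasurable (fun w => ‖g w‖ ^ q) ν :=
      (hg.1.norm.aemeasurable.pow_const q).aestronglyMeasurable
    rw [← integrable_norm_rpow_iff hmeas (by simpa using hs) ENNReal.ofReal_ne_top,
      ENNReal.toReal_ofReal hs.le]
    have hpow (w : X) : ‖‖g w‖ ^ q‖ ^ s = ‖g w‖ ^ (q * s) := by
      rw [Real.norm_of_nonneg (by positivity), ← Real.rpow_mul (norm_nonneg _)]
    simp_rw [hpow]
    have hqs0 : 0 < q * s := by positivity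
    have := (hg.mono_exponent (p := ENNReal.ofReal (q * s))
      (by rw [← ENNReal.ofReal_ofNat 2]; exact ENNReal.ofReal_le_ofReal hqs)).integrable_norm_rpow
      (by simpa using hqs0) ENNReal.ofReal_ne_top
    rwa [ENNReal.toReal_ofReal hqs0.le] at this
  -- Hölder for `|g| = |g|^(p/(2-p)) · |g|^(2(1-p)/(2-p))`; the conjugate exponents `2 - p` and
  -- `(2-p)/(1-p)` turn the factors into `|g|^p` and `|g|²`.
  have key := integral_mul_le_Lp_mul_Lq_of_nonneg (μ := ν) hconj
    (f := fun w => ‖g w‖ ^ (p / (2 - p))) (g := fun w => ‖g w‖ ^ (2 * (1 - p) / (2 - p)))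
    (ae_of_all _ fun w => by positivity) (ae_of_all _ fun w => by positivity)
    (hmem (by positivity) h2p (by rw [div_mul_cancel₀ _ h2p.ne']; linarith))
    (hmem (by positivity) (by positivity) (by
      have : 2 * (1 - p) / (2 - p) * ((2 - p) / (1 - p)) = 2 := by field_simp
      rw [this]))
  have e1 (w : X) : ‖g w‖ ^ (p / (2 - p)) * ‖g w‖ ^ (2 * (1 - p) / (2 - p)) = ‖g w‖ := by
    have : p / (2 - p) + 2 * (1 - p) / (2 - p) = 1 := by field_simp; ring
    rw [← Real.rpow_add_of_nonneg (norm_nonneg _) (by positivity) (by positivity), this,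
      Real.rpow_one]
  have e2 (w : X) : (‖g w‖ ^ (p / (2 - p))) ^ (2 - p) = ‖g w‖ ^ p := by
    rw [← Real.rpow_mul (norm_nonneg _), div_mul_cancel₀ _ h2p.ne']
  have e3 (w : X) : (‖g w‖ ^ (2 * (1 - p) / (2 - p))) ^ ((2 - p) / (1 - p)) = ‖g w‖ ^ 2 := by
    have : 2 * (1 - p) / (2 - p) * ((2 - p) / (1 - p)) = 2 := by field_simp
    rw [← Real.rpow_mul (norm_nonneg _), this, Real.rpow_two]
  simpa only [e1, e2, e3] using key

end Interpolation

end RankOneUnitary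

/-! ### Assembly of the bound. -/

theorem proposition4p1 {H : Type*} [NormedAddCommGroup H] [InnerProductSpace ℂ H]
    [CompleteSpace H] (U : unitary (H →L[ℂ] H)) (φ : H) (hφ : ‖φ‖ = 1)
    (hcyc : IsCyclicVector U φ)
    (hG : ∀ᵐ z₀ ∂(arcMeasure), simonWolffG U φ z₀ < ∞)
    (ψ : H) (hψφ : ⟪φ, ψ⟫_ℂ = 0) (hψ : ‖ψ‖ ≤ 1) :
    ∀ᵐ l ∂(arcMeasure), ∀ p : ℝ, 0 < p → p < 1 →
      (∀ᵐ z ∂(spectralMeasure (perturb U hφ l) φ),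
        Tendsto (radial U φ ψ p z) (𝓝[<] (1 : ℝ))
          (𝓝 (radialLimit U φ ψ p z))) ∧
      Integrable (radialLimit U φ ψ p)
        (spectralMeasure (perturb U hφ l) φ) ∧
      BddAbove (range fun n : ℤ =>
        ‖⟪φ, ((perturb U hφ l ^ n : unitary (H →L[ℂ] H)) : H →L[ℂ] H) ψ⟫_ℂ‖) ∧
      (⨆ n : ℤ,
        ‖⟪φ, ((perturb U hφ l ^ n : unitary (H →L[ℂ] H)) : H →L[ℂ] H) ψ⟫_ℂ‖) ≤
        (∫ z, radialLimit U φ ψ p z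
          ∂(spectralMeasure (perturb U hφ l) φ)) ^ (1 / (2 - p)) := by
  have hne : ∀ᵐ l ∂arcMeasure, l ≠ 1 := by
    rw [ae_iff]; simpa using arcMeasure_singleton_one
  -- The exceptional set of `λ` is fixed before `p`; it includes `λ = 1`, where `λ⁻¹ - 1` vanishes.
  filter_upwards [ae_ae_spectralMeasure_perturb U hφ hG, hne] with l hlG hl p hp0 hp1
  have hatom := ae_atom_of_ae_simonWolffG_lt_top U hφ l hlG
  obtain ⟨g, hg2, hgψ, hrep⟩ := exists_spectral_representative (perturb U hφ l) φ ψ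
  set ν := spectralMeasure (perturb U hφ l) φ
  have hgint : Integrable g ν := hg2.integrable (by norm_num)
  set κ : ℝ := 2 / ‖(l : ℂ)⁻¹ - 1‖ with hκ
  have hl' : 0 < ‖(l : ℂ)⁻¹ - 1‖ := by
    rw [norm_pos_iff, sub_ne_zero, Ne, inv_eq_one]
    exact fun h => hl (Circle.ext h)
  -- This is what lets `|g|^p` be replaced by the larger radial limit `(κ |g|)^p` at the end.
  have hκ1 : 1 ≤ κ := by
    rw [hκ, one_le_div hl']
    refine (norm_sub_le _ _).trans_eq ?_
    rw [norm_inv, Circle.norm_coe]; norm_num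
  have hlim : ∀ᵐ z ∂ν, Tendsto (radial U φ ψ p z) (𝓝[<] (1 : ℝ)) (𝓝 ((κ * ‖g z‖) ^ p)) := by
    filter_upwards [hatom] with z hz
    have h := (tendsto_inner_cayley_of_atom U hφ hψφ hl hgint hrep hz).norm.rpow_const
      (p := p) (Or.inr hp0.le)
    have heq : ‖2 * g z / ((l : ℂ)⁻¹ - 1)‖ = κ * ‖g z‖ := by
      rw [norm_div, norm_mul, hκ, Complex.norm_ofNat]; ring
    rwa [heq] at h
  have hval : radialLimit U φ ψ p =ᵐ[ν] fun z => κ ^ p * ‖g z‖ ^ p := by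
    filter_upwards [hlim] with z hz
    rw [← Real.mul_rpow (by positivity) (norm_nonneg _)]
    exact hz.limUnder_eq
  have hgp : Integrable (fun z => ‖g z‖ ^ p) ν := by
    have := (hg2.mono_exponent (p := ENNReal.ofReal p) (by
      rw [← ENNReal.ofReal_ofNat 2]
      exact ENNReal.ofReal_le_ofReal (by linarith))).integrable_norm_rpow
      (by simpa using hp0) ENNReal.ofReal_ne_top
    rwa [ENNReal.toReal_ofReal hp0.le] at this
  have hbound (n : ℤ) : ‖⟪φ, ((perturb U hφ l ^ n : unitary (H →L[ℂ] H)) : H →L[ℂ] H) ψ⟫_ℂ‖ ≤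
      (∫ z, radialLimit U φ ψ p z ∂ν) ^ (1 / (2 - p)) := by
    have h2p : 0 ≤ 1 / (2 - p) := div_nonneg zero_le_one (by linarith)
    have hgnn : 0 ≤ ∫ z, ‖g z‖ ^ p ∂ν := integral_nonneg fun z => by positivity
    calc ‖⟪φ, ((perturb U hφ l ^ n : unitary (H →L[ℂ] H)) : H →L[ℂ] H) ψ⟫_ℂ‖
        = ‖∫ w, circlePow n w * g w ∂ν‖ := by rw [← circleCalc_circlePow, hrep]
      _ ≤ ∫ w, ‖g w‖ ∂ν := by
        refine (norm_integral_le_integral_norm _).trans_eq ?_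
        simp_rw [norm_mul, circlePow_apply, Circle.norm_coe, one_mul]
      _ ≤ (∫ w, ‖g w‖ ^ p ∂ν) ^ (1 / (2 - p)) *
          (∫ w, ‖g w‖ ^ 2 ∂ν) ^ (1 / ((2 - p) / (1 - p))) :=
        integral_norm_le_rpow_mul_rpow hg2 hp0 hp1
      -- The second moment is at most `‖ψ‖² ≤ 1`, so its nonnegative power can be dropped.
      _ ≤ (∫ w, ‖g w‖ ^ p ∂ν) ^ (1 / (2 - p)) := by
        refine mul_le_of_le_one_right (by positivity) (Real.rpow_le_one
          (integral_nonneg fun z => by positivity)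
          (hgψ.trans (pow_le_one₀ (norm_nonneg _) hψ)) ?_)
        exact div_nonneg zero_le_one (div_nonneg (by linarith) (by linarith))
      _ ≤ (∫ z, radialLimit U φ ψ p z ∂ν) ^ (1 / (2 - p)) := by
        refine Real.rpow_le_rpow hgnn ?_ h2p
        rw [integral_congr_ae hval, integral_const_mul]
        exact le_mul_of_one_le_left hgnn (Real.one_le_rpow hκ1 hp0.le)
  refine ⟨?_, (hgp.const_mul _).congr hval.symm, ⟨_, forall_mem_range.2 hbound⟩, ciSup_le hbound⟩
  filter_upwards [hlim] with z hz
  rwa [show radialLimit U φ ψ p z = _ from hz.limUnder_eq]
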